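/- Let $T>0$ and let $J$ be the time interval $[0,T)$ or $[0,T]$. Let $c_0(\cdot,t)\in L^1(\mathbb R^N)$ $(t\in J)$ and $c_1:\mathbb R^N\times J\to\mathbb R$ satisfy (H1) $c_0\in C(J;L^1(\mathbb R^N))$ and $D_xc_0\in L^\infty(J;L^1(\mathbb R^N))$, where $D_x$ is the distributional gradient; $c_1\in C(\mathbb R^N\times J)$; and there are constants $M_0,M_1,L_1$ with $\|c_0(\cdot,t)\|_{L^1}\le M_0$, $|c_1(x,t)|\le M_1$ and $|c_1(x,t)-c_1(y,t)|\le L_1|x-y|$ for all $x,y\in\mathbb R^N$, $t\in J$. Assume that $c_0\ge 0$ and that $u_0:\mathbb R^N\to\mathbb R$ is bounded and uniformly continuous. For $u:\mathbb R^N\times J\to\mathbb R$ put $$c^{+}[u](x,t)=c_1(x,t)+\int_{\mathbb R^N}c_0(x-z,t)\mathbf 1_{\{u(\cdot,t)\ge u(x,t)\}}(z)\,dz,\qquad c^{-}[u](x,t)=c_1(x,t)+\int_{\mathbb R^N}c_0(x-z,t)\mathbf 1_{\{u(\cdot,t)> u(x,t)\}}(z)\,dz .$$ An upper-semicontinuous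 $u:\mathbb R^N\times J\to\mathbb R$ is a subsolution if, for every $\varphi\in C^1(\mathbb R^N\times J)$ and every maximum point $(\bar x,\bar t)\in\mathbb R^N\times J$ of $u-\varphi$, one has $\varphi_t(\bar x,\bar t)\le c^{+}[u](\bar x,\bar t)|D\varphi(\bar x,\bar t)|$ if $\bar t>0$, and $u(\bar x,0)\le u_0(\bar x)$ if $\bar t=0$. A lower-semicontinuous $u$ is a supersolution if, for every such $\varphi$ and every minimum point $(\bar x,\bar t)$ of $u-\varphi$, one has $\varphi_t(\bar x,\bar t)\ge c^{-}[u](\bar x,\bar t)|D\varphi(\bar x,\bar t)|$ if $\bar t>0$, and $u(\bar x,0)\ge u_0(\bar x)$ if $\bar t=0$. A locally bounded function on $\mathbb R^N\times J$ is a viscosity solution (in Slepčev's sense) of $$u_t=\big(c_0(\cdot,t)\star\mathbf 1_{\{u(\cdot,t)\ge u(x,t)\}}(x)+c_1(x,t)\big)|Du|,\qquad u(\cdot,0)=u_0, \tag{1}$$ if its upper-semicontinuous envelope is a subsolution and its lower-semicontinuous envelope is a supersolution. Then (1) has exactly one viscosity solution $u$ on $\mathbb R^N\times J$. It satisfies $u(\cdot,0)=u_0$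 and is continuous; when $J=[0,T)$ it extends continuously to $\mathbb R^N\times[0,T]$. -/

import Mathlib

open MeasureTheory Set Filter Topology
open scoped ContDiff

/-- The space `ℝ^N` with its Euclidean norm. -/
abbrev RN (N : ℕ) : Type := EuclideanSpace ℝ (Fin N)

/-- The space-time cylinder `ℝ^N × J`, for a set `J` of times. -/
def cyl (N : ℕ) (J : Set ℝ) : Set (RN N × ℝ) := univ ×ˢ J

/-- `g` is the gradient of `f` on `ℝ^N` in the sense of distributions. -/
def HasWeakGradient {N : ℕ} (f : RN N → ℝ) (g : RN N → RN N) : Prop :=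
  LocallyIntegrable f ∧ LocallyIntegrable g ∧
    ∀ ψ : RN N → ℝ, ContDiff ℝ ∞ ψ → HasCompactSupport ψ →
      ∫ x, f x • gradient ψ x = - ∫ x, ψ x • g x

/-- The regularity assumptions on the kernel `c₀` and on the driving force `c₁`, on the time
set `J`: `c₀ ∈ C(J; L¹(ℝ^N))` is bounded, `D_x c₀ ∈ L^∞(J; L¹(ℝ^N))`, and `c₁ ∈ C(ℝ^N × J)` is
bounded and Lipschitz continuous in space, uniformly in time. -/
structure VelocityRegularity {N : ℕ} (J : Set ℝ)
    (c₀ : ℝ → Lp ℝ 1 (volume : Measure (RN N))) (c₁ : RN N × ℝ → ℝ) : Prop where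
  kernel_continuous : ContinuousOn c₀ J
  kernel_bounded : ∃ M₀ : ℝ, ∀ t ∈ J, ‖c₀ t‖ ≤ M₀
  kernel_gradient : ∃ L₀ : ℝ, ∀ᵐ t ∂(volume.restrict J), ∃ g : RN N → RN N,
    HasWeakGradient (c₀ t) g ∧ Integrable g ∧ ∫ x, ‖g x‖ ≤ L₀
  force_continuous : ContinuousOn c₁ (cyl N J)
  force_bounded : ∃ M₁ : ℝ, ∀ x, ∀ t ∈ J, |c₁ (x, t)| ≤ M₁
  force_lipschitz : ∃ L₁ : ℝ, ∀ x y, ∀ t ∈ J, |c₁ (x, t) - c₁ (y, t)| ≤ L₁ * ‖x - y‖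

/-- The nonlocal velocity
`c⁺[u](x,t) = c₁(x,t) + ∫ c₀(x-z,t) 1_{u(·,t) ≥ u(x,t)}(z) dz`. -/
noncomputable def cPlus {N : ℕ} (c₀ : ℝ → Lp ℝ 1 (volume : Measure (RN N)))
    (c₁ : RN N × ℝ → ℝ) (u : RN N × ℝ → ℝ) (x : RN N) (t : ℝ) : ℝ :=
  c₁ (x, t) + ∫ z, c₀ t (x - z) * {y | u (y, t) ≥ u (x, t)}.indicator (fun _ => (1 : ℝ)) z

/-- The nonlocal velocity
`c⁻[u](x,t) = c₁(x,t) + ∫ c₀(x-z,t) 1_{u(·,t) > u(x,t)}(z) dz`. -/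
noncomputable def cMinus {N : ℕ} (c₀ : ℝ → Lp ℝ 1 (volume : Measure (RN N)))
    (c₁ : RN N × ℝ → ℝ) (u : RN N × ℝ → ℝ) (x : RN N) (t : ℝ) : ℝ :=
  c₁ (x, t) + ∫ z, c₀ t (x - z) * {y | u (y, t) > u (x, t)}.indicator (fun _ => (1 : ℝ)) z

/-- Subsolutions in Slepčev's sense on `ℝ^N × J`. The values of `u` outside `ℝ^N × J` play no
role, and derivatives of the test function at an end point of `J` are one-sided. -/
def IsSlepcevSubsolution {N : ℕ} (J : Set ℝ) (c₀ : ℝ → Lp ℝ 1 (volume : Measure (RN N)))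
    (c₁ : RN N × ℝ → ℝ) (u₀ : RN N → ℝ) (u : RN N × ℝ → ℝ) : Prop :=
  UpperSemicontinuousOn u (cyl N J) ∧
  ∀ φ : RN N × ℝ → ℝ, ContDiffOn ℝ 1 φ (cyl N J) →
    ∀ (x : RN N) (t : ℝ), t ∈ J → IsMaxOn (fun p => u p - φ p) (cyl N J) (x, t) →
      (0 < t → derivWithin (fun s => φ (x, s)) J t
          ≤ cPlus c₀ c₁ u x t * ‖gradient (fun y => φ (y, t)) x‖) ∧
      (t = 0 → u (x, 0) ≤ u₀ x)

/-- Supersolutions in Slepčev's sense on `ℝ^N × J`. -/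
def IsSlepcevSupersolution {N : ℕ} (J : Set ℝ) (c₀ : ℝ → Lp ℝ 1 (volume : Measure (RN N)))
    (c₁ : RN N × ℝ → ℝ) (u₀ : RN N → ℝ) (u : RN N × ℝ → ℝ) : Prop :=
  LowerSemicontinuousOn u (cyl N J) ∧
  ∀ φ : RN N × ℝ → ℝ, ContDiffOn ℝ 1 φ (cyl N J) →
    ∀ (x : RN N) (t : ℝ), t ∈ J → IsMinOn (fun p => u p - φ p) (cyl N J) (x, t) →
      (0 < t → cMinus c₀ c₁ u x t * ‖gradient (fun y => φ (y, t)) x‖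
          ≤ derivWithin (fun s => φ (x, s)) J t) ∧
      (t = 0 → u₀ x ≤ u (x, 0))

/-- `u` is locally bounded on `S`. -/
def LocallyBoundedOn {X : Type*} [TopologicalSpace X] (u : X → ℝ) (S : Set X) : Prop :=
  ∀ p ∈ S, ∃ C : ℝ, ∀ᶠ q in 𝓝[S] p, |u q| ≤ C

/-- The upper-semicontinuous envelope of `u` on `S` (for `u` locally bounded on `S`). -/
noncomputable def uscEnvelope {X : Type*} [TopologicalSpace X] (S : Set X) (u : X → ℝ) (p : X) :
    ℝ :=
  limsup u (𝓝[S] p)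

/-- The lower-semicontinuous envelope of `u` on `S` (for `u` locally bounded on `S`). -/
noncomputable def lscEnvelope {X : Type*} [TopologicalSpace X] (S : Set X) (u : X → ℝ) (p : X) :
    ℝ :=
  liminf u (𝓝[S] p)

/-- Viscosity solutions in Slepčev's sense, on `ℝ^N × J` and with initial datum `u₀`, of
`u_t = (c₀(·,t) ⋆ 1_{u(·,t) ≥ u(x,t)} (x) + c₁(x,t)) |Du|`. -/
def IsSlepcevSolution {N : ℕ} (J : Set ℝ) (c₀ : ℝ → Lp ℝ 1 (volume : Measure (RN N)))
    (c₁ : RN N × ℝ → ℝ) (u₀ : RN N → ℝ) (u : RN N × ℝ → ℝ) : Prop :=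
  LocallyBoundedOn u (cyl N J) ∧
  IsSlepcevSubsolution J c₀ c₁ u₀ (uscEnvelope (cyl N J) u) ∧
  IsSlepcevSupersolution J c₀ c₁ u₀ (lscEnvelope (cyl N J) u)

/-! The proof rests on two estimates and on Perron's method. The velocities `c⁺`, `c⁻` are bounded
by a constant `K`, so subsolutions, and opposites of supersolutions, are subsolutions of the local
equation `u_t = K |Du|`.

*Finite speed.* Test functions may grow arbitrarily fast in space, and blow up at an end point of
`J` which is not in `J`; therefore no growth condition is needed to compare a subsolution with the
barriers `A + C (√(1 + |x - x₀|²) - 1 + K t)` (`IsEikonalSubsolution.le_barrier`). It follows that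
subsolutions are bounded above, that they attain the initial datum uniformly in space, and that a
modulus of continuity in space at one time gives a modulus in time.

*Comparison* (`sub_le_modulus`). The maximum of `u(x,t) - v(y,s)`, penalized by
`C e^{γ t} (√(1 + |x - y|²) - 1)`, is considered. If `u(z,t) ≥ u(x,t)`, then translating `z` by a
vector slightly shorter than `y - x` strictly decreases the penalty, and hence
`v(z + (1 - θ)(y - x), s) > v(y,s)`: the translate of the superlevel set that enters `c⁺[u]` lies in
the strict superlevel set that enters `c⁻[v]`, up to points so far away that they do not matter
because `c₀` is uniformly tight on compact sets of times. As `c₀ ≥ 0` and as translations are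
continuous in `L¹`, this gives `c⁺[u](x,t) - c⁻[v](y,s) ≤ L₁ |x - y| + o(1)`, and the exponential
factor with `γ = 2 L₁` absorbs the first term. Where the gradient of the penalty is small, the
boundedness of the velocities suffices. The outcome is both the comparison principle and a modulus
of continuity in space.

*Existence.* The upper envelope of the supremum of all subsolutions is the greatest subsolution `W`,
since the viscosity inequality is stable under half-relaxed limits (`exists_greatest_subsolution`).
Its lower envelope is a supersolution, since otherwise the maximum of `W` and a small smooth bump
would be a larger subsolution (`isSlepcevSupersolution_of_greatest`); here `c₀ ≥ 0` makes `c⁺`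
monotone. By comparison `W` is continuous, and the modulus of continuity in space and time gives the
continuous extension to the closed cylinder. -/

/-! ### Exhaustions of the time interval -/

/-- `ρ` is a smooth nondecreasing exhaustion of the time interval `J`, whose end points are `0` and
`T`: its sublevel sets in `J` are compact. It penalizes the approach of an end point of `J` that
does not belong to `J`. -/
structure IsTimeExhaustion (J : Set ℝ) (T : ℝ) (ρ : ℝ → ℝ) : Prop where
  zero_mem : (0 : ℝ) ∈ J
  nonneg : ∀ t ∈ J, 0 ≤ t
  le : ∀ t ∈ J, t ≤ T
  convex : Convex ℝ J
  uniqueDiffOn : UniqueDiffOn ℝ J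
  Icc_subset_closure : Icc 0 T ⊆ closure J
  contDiffOn : ContDiffOn ℝ 1 ρ J
  monotoneOn : MonotoneOn ρ J
  weight_nonneg : ∀ t ∈ J, 0 ≤ ρ t
  isCompact_sublevel : ∀ r, IsCompact {t ∈ J | ρ t ≤ r}

theorem exists_isTimeExhaustion {T : ℝ} (hT : 0 < T) {J : Set ℝ}
    (hJ : J = Ico 0 T ∨ J = Icc 0 T) : ∃ ρ, IsTimeExhaustion J T ρ := by
  rcases hJ with rfl | rfl
  · refine ⟨fun t => (T - t)⁻¹, ⟨by simp [hT], fun t ht => ht.1, fun t ht => ht.2.le,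
      convex_Ico 0 T, uniqueDiffOn_Ico 0 T, by rw [closure_Ico hT.ne], ?_, ?_, ?_, ?_⟩⟩
    · exact ContDiffOn.inv (by fun_prop) fun t ht => (sub_pos.2 ht.2).ne'
    · intro s _ t ht hst
      have := ht.2
      exact inv_anti₀ (by linarith) (by linarith)
    · intro t ht
      have := ht.2
      exact inv_nonneg.2 (by linarith)
    · intro r
      rcases le_or_gt r 0 with hr | hr
      · convert isCompact_empty
        ext t
        simp only [mem_ofPred_eq, mem_Ico, mem_empty_iff_false, iff_false, not_and, and_imp]
        intro _ h2
        have : 0 < (T - t)⁻¹ := inv_pos.2 (by linarith)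
        linarith
      · have : {t ∈ Ico 0 T | (T - t)⁻¹ ≤ r} = Icc 0 (T - r⁻¹) := by
          ext t
          simp only [mem_ofPred_eq, mem_Ico, mem_Icc]
          constructor
          · rintro ⟨⟨h1, h2⟩, h3⟩
            have := (inv_le_comm₀ (by linarith) hr).1 h3
            exact ⟨h1, by linarith⟩
          · rintro ⟨h1, h2⟩
            have h3 : 0 < r⁻¹ := inv_pos.2 hr
            exact ⟨⟨h1, by linarith⟩, (inv_le_comm₀ (by linarith) hr).2 (by linarith)⟩
        rw [this]
        exact isCompact_Icc
  · refine ⟨fun _ => 0, ⟨by simp [hT.le], fun t ht => ht.1, fun t ht => ht.2,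
      convex_Icc 0 T, uniqueDiffOn_Icc hT, subset_closure, contDiffOn_const,
      monotoneOn_const, fun _ _ => le_rfl, fun r => ?_⟩⟩
    exact isCompact_Icc.of_isClosed_subset
      (isClosed_Icc.inter (isClosed_const (p := (0 : ℝ) ≤ r))) fun t ht => ht.1

section TimeExhaustion

variable {J : Set ℝ} {T : ℝ} {ρ : ℝ → ℝ}

theorem IsTimeExhaustion.hasDerivWithinAt (hρ : IsTimeExhaustion J T ρ) {t : ℝ} (ht : t ∈ J) :
    HasDerivWithinAt ρ (derivWithin ρ J t) J t :=
  (hρ.contDiffOn.differentiableOn one_ne_zero t ht).hasDerivWithinAt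

theorem IsTimeExhaustion.derivWithin_nonneg (hρ : IsTimeExhaustion J T ρ) (t : ℝ) :
    0 ≤ derivWithin ρ J t :=
  hρ.monotoneOn.derivWithin_nonneg

theorem IsTimeExhaustion.pos (hρ : IsTimeExhaustion J T ρ) {t : ℝ} (ht : t ∈ J) (h : t ≠ 0) :
    0 < t :=
  lt_of_le_of_ne (hρ.nonneg t ht) h.symm

theorem IsTimeExhaustion.contDiffOn_snd (hρ : IsTimeExhaustion J T ρ) (N : ℕ) :
    ContDiffOn ℝ 1 (fun p : RN N × ℝ => ρ p.2) (cyl N J) :=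
  hρ.contDiffOn.comp contDiff_snd.contDiffOn fun _ hp => hp.2

theorem IsTimeExhaustion.uniqueDiffOn_cyl (hρ : IsTimeExhaustion J T ρ) (N : ℕ) :
    UniqueDiffOn ℝ (cyl N J) :=
  uniqueDiffOn_univ.prod hρ.uniqueDiffOn

/-- The compact pieces that exhaust the cylinder. -/
theorem IsTimeExhaustion.isCompact_piece (hρ : IsTimeExhaustion J T ρ) {N : ℕ} (x₀ : RN N)
    (R r : ℝ) : IsCompact (Metric.closedBall x₀ R ×ˢ {t ∈ J | ρ t ≤ r}) :=
  (isCompact_closedBall x₀ R).prod (hρ.isCompact_sublevel r)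

theorem piece_subset_cyl {N : ℕ} (x₀ : RN N) (R r : ℝ) :
    Metric.closedBall x₀ R ×ˢ {t ∈ J | ρ t ≤ r} ⊆ cyl N J :=
  fun _ hp => ⟨mem_univ _, hp.2.1⟩

end TimeExhaustion

/-- An upper semicontinuous function attains its maximum when one of its superlevel sets lies in a
compact set. -/
theorem exists_isMaxOn_of_superlevel_subset {X : Type*} [TopologicalSpace X] {S k : Set X}
    {f : X → ℝ} (hf : UpperSemicontinuousOn f S) {p₀ : X} (hp₀ : p₀ ∈ S) (hk : IsCompact k)
    (hkS : k ⊆ S) (h : ∀ p ∈ S, f p₀ ≤ f p → p ∈ k) : ∃ p ∈ S, IsMaxOn f S p ∧ f p₀ ≤ f p := by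
  obtain ⟨p, hp, hmax⟩ := (hf.mono hkS).exists_isMaxOn ⟨p₀, h p₀ hp₀ le_rfl⟩ hk
  have h0 : f p₀ ≤ f p := hmax (h p₀ hp₀ le_rfl)
  refine ⟨p, hkS hp, fun q hq => ?_, h0⟩
  rcases le_total (f p₀) (f q) with hle | hle
  · exact hmax (h q hq hle)
  · exact hle.trans h0

theorem UpperSemicontinuousOn.sub_continuousOn {X : Type*} [TopologicalSpace X] {S : Set X}
    {f φ : X → ℝ} (hf : UpperSemicontinuousOn f S) (hφ : ContinuousOn φ S) :
    UpperSemicontinuousOn (fun p => f p - φ p) S := by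
  have h := hf.add hφ.neg.upperSemicontinuousOn
  have h2 : (fun p => f p - φ p) = fun p => f p + (-φ) p := funext fun p => sub_eq_add_neg _ _
  rw [h2]
  exact h

/-! ### Smooth auxiliary functions -/

/-- The smooth function `√(1 + |x|²) - 1`, which behaves like `|x|²` near the origin and like `|x|`
at infinity. -/
noncomputable def softNorm {N : ℕ} (x : RN N) : ℝ := √(1 + ‖x‖ ^ 2) - 1

section SoftNorm

variable {N : ℕ}

theorem one_le_sqrt_one_add_norm_sq (x : RN N) : 1 ≤ √(1 + ‖x‖ ^ 2) :=
  Real.one_le_sqrt.2 (by nlinarith [sq_nonneg ‖x‖])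

theorem softNorm_nonneg (x : RN N) : 0 ≤ softNorm x :=
  sub_nonneg.2 (one_le_sqrt_one_add_norm_sq x)

@[simp] theorem softNorm_zero : softNorm (0 : RN N) = 0 := by simp [softNorm]

theorem softNorm_neg (x : RN N) : softNorm (-x) = softNorm x := by simp [softNorm]

theorem softNorm_sub_comm (x y : RN N) : softNorm (x - y) = softNorm (y - x) := by
  rw [← softNorm_neg, neg_sub]

theorem norm_le_softNorm_add_one (x : RN N) : ‖x‖ ≤ softNorm x + 1 := by
  rw [softNorm, sub_add_cancel]
  exact Real.le_sqrt_of_sq_le (by linarith)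

theorem contDiff_softNorm : ContDiff ℝ 1 (softNorm : RN N → ℝ) :=
  ((contDiff_const.add (contDiff_norm_sq ℝ)).sqrt fun x => by positivity).sub contDiff_const

theorem continuous_softNorm : Continuous (softNorm : RN N → ℝ) := contDiff_softNorm.continuous

theorem hasFDerivAt_softNorm (x : RN N) : HasFDerivAt softNorm (fderiv ℝ softNorm x) x :=
  (contDiff_softNorm.differentiable one_ne_zero x).hasFDerivAt

theorem hasFDerivAt_softNorm_sub (x₀ x : RN N) :
    HasFDerivAt (fun y => softNorm (y - x₀)) (fderiv ℝ softNorm (x - x₀)) x := by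
  have h := (hasFDerivAt_softNorm (x - x₀)).comp x ((hasFDerivAt_id x).sub_const x₀)
  rw [ContinuousLinearMap.comp_id] at h
  exact h

theorem norm_fderiv_softNorm (x : RN N) :
    ‖fderiv ℝ softNorm x‖ = ‖x‖ / √(1 + ‖x‖ ^ 2) := by
  have h1 : HasFDerivAt (fun y : RN N => 1 + ‖y‖ ^ 2) (2 • innerSL ℝ x) x :=
    (hasStrictFDerivAt_norm_sq x).hasFDerivAt.const_add 1
  have h2 := (h1.sqrt (by positivity)).sub_const 1
  have h3 : fderiv ℝ softNorm x = _ := h2.fderiv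
  rw [h3, norm_smul, ← Nat.cast_smul_eq_nsmul ℝ, norm_smul, innerSL_apply_norm]
  have := one_le_sqrt_one_add_norm_sq x
  rw [Real.norm_of_nonneg (by positivity), Real.norm_of_nonneg (by positivity)]
  push_cast
  field_simp

theorem norm_fderiv_softNorm_le_one (x : RN N) : ‖fderiv ℝ softNorm x‖ ≤ 1 := by
  rw [norm_fderiv_softNorm]
  exact div_le_one_of_le₀ (by linarith [norm_le_softNorm_add_one x, show softNorm x
    = √(1 + ‖x‖ ^ 2) - 1 from rfl]) (by positivity)

theorem norm_fderiv_softNorm_sq_le (x : RN N) : ‖fderiv ℝ softNorm x‖ ^ 2 ≤ 2 * softNorm x := by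
  have h1 := one_le_sqrt_one_add_norm_sq x
  have h2 : √(1 + ‖x‖ ^ 2) ^ 2 = 1 + ‖x‖ ^ 2 := Real.sq_sqrt (by positivity)
  rw [norm_fderiv_softNorm, div_pow, softNorm, div_le_iff₀ (by positivity)]
  generalize √(1 + ‖x‖ ^ 2) = s at *
  rw [show ‖x‖ ^ 2 = s ^ 2 - 1 by linarith]
  nlinarith [mul_nonneg (mul_nonneg (sub_nonneg.2 h1) (sub_nonneg.2 h1)) (by linarith : 0 ≤ s),
    mul_nonneg (sub_nonneg.2 h1) (by linarith : 0 ≤ s)]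

theorem norm_mul_norm_fderiv_softNorm_le (x : RN N) :
    ‖x‖ * ‖fderiv ℝ softNorm x‖ ≤ 2 * softNorm x := by
  have h1 := one_le_sqrt_one_add_norm_sq x
  have h2 : √(1 + ‖x‖ ^ 2) ^ 2 = 1 + ‖x‖ ^ 2 := Real.sq_sqrt (by positivity)
  rw [norm_fderiv_softNorm, softNorm, mul_div_assoc', div_le_iff₀ (by positivity)]
  generalize √(1 + ‖x‖ ^ 2) = s at *
  nlinarith

theorem softNorm_smul_le {θ : ℝ} (h0 : 0 ≤ θ) (h1 : θ ≤ 1) (x : RN N) :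
    softNorm (θ • x) ≤ θ * softNorm x := by
  have hs := one_le_sqrt_one_add_norm_sq x
  have h2 : √(1 + ‖x‖ ^ 2) ^ 2 = 1 + ‖x‖ ^ 2 := Real.sq_sqrt (by positivity)
  rw [softNorm, softNorm, norm_smul, Real.norm_of_nonneg h0, sub_le_iff_le_add]
  generalize √(1 + ‖x‖ ^ 2) = s at *
  refine Real.sqrt_le_iff.2 ⟨by nlinarith [mul_nonneg h0 (sub_nonneg.2 hs)], ?_⟩
  have : (θ * (s - 1) + 1) ^ 2 - (1 + (θ * ‖x‖) ^ 2) = 2 * θ * (1 - θ) * (s - 1) := by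
    rw [mul_pow, show ‖x‖ ^ 2 = s ^ 2 - 1 by linarith]
    ring
  nlinarith [mul_nonneg (mul_nonneg (mul_nonneg zero_le_two h0) (sub_nonneg.2 h1))
    (sub_nonneg.2 hs)]

theorem softNorm_sub_softNorm_le (x y : RN N) : softNorm x - softNorm y ≤ ‖x - y‖ := by
  have := Convex.norm_image_sub_le_of_norm_fderiv_le (𝕜 := ℝ) (f := (softNorm : RN N → ℝ))
    (fun z _ => contDiff_softNorm.differentiable one_ne_zero z)
    (fun z _ => norm_fderiv_softNorm_le_one z) convex_univ (mem_univ y) (mem_univ x)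
  rw [one_mul] at this
  exact (le_abs_self _).trans this

/-- A bounded uniformly continuous function has a modulus of continuity of the form
`m + C (√(1 + |x - y|²) - 1)` for every `m > 0`. -/
theorem UniformContinuous.exists_softNorm_modulus {f : RN N → ℝ} (hf : UniformContinuous f)
    (hb : ∃ B : ℝ, ∀ x, |f x| ≤ B) {m : ℝ} (hm : 0 < m) :
    ∃ C, 0 ≤ C ∧ ∀ x y, f x - f y ≤ m + C * softNorm (x - y) := by
  obtain ⟨B, hB⟩ := hb
  obtain ⟨δ, hδ, h⟩ := Metric.uniformContinuous_iff.1 hf m hm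
  have hκ : 0 < √(1 + δ ^ 2) - 1 :=
    sub_pos.2 (Real.lt_sqrt_of_sq_lt (by nlinarith [pow_pos hδ 2]))
  have hB0 : 0 ≤ B := (abs_nonneg _).trans (hB 0)
  refine ⟨2 * B / (√(1 + δ ^ 2) - 1), by positivity, fun x y => ?_⟩
  rcases lt_or_ge (dist x y) δ with hxy | hxy
  · have h1 := (le_abs_self _).trans_lt (h hxy)
    have h2 : 0 ≤ 2 * B / (√(1 + δ ^ 2) - 1) * softNorm (x - y) :=
      mul_nonneg (by positivity) (softNorm_nonneg _)
    linarith
  · have h1 : √(1 + δ ^ 2) - 1 ≤ softNorm (x - y) := by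
      rw [dist_eq_norm] at hxy
      exact sub_le_sub_right (Real.sqrt_le_sqrt (by gcongr)) 1
    have h2 : 2 * B ≤ 2 * B / (√(1 + δ ^ 2) - 1) * softNorm (x - y) := by
      rw [div_mul_eq_mul_div, le_div_iff₀ hκ]
      gcongr
    linarith [(abs_le.1 (hB x)).2, (abs_le.1 (hB y)).1]

end SoftNorm

/-- The square of the positive part. -/
def posSq (r : ℝ) : ℝ := max r 0 ^ 2

theorem posSq_nonneg (r : ℝ) : 0 ≤ posSq r := sq_nonneg _

theorem posSq_of_nonpos {r : ℝ} (h : r ≤ 0) : posSq r = 0 := by simp [posSq, h]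

theorem posSq_of_nonneg {r : ℝ} (h : 0 ≤ r) : posSq r = r ^ 2 := by simp [posSq, h]

theorem hasDerivAt_posSq (r : ℝ) : HasDerivAt posSq (2 * max r 0) r := by
  rcases lt_trichotomy r 0 with h | rfl | h
  · have : posSq =ᶠ[𝓝 r] fun _ => 0 := by
      filter_upwards [Iio_mem_nhds h] with s hs using posSq_of_nonpos (le_of_lt hs)
    rw [max_eq_right h.le, mul_zero]
    exact (hasDerivAt_const r (0 : ℝ)).congr_of_eventuallyEq this
  · rw [max_self, mul_zero, hasDerivAt_iff_isLittleO_nhds_zero]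
    refine Asymptotics.IsLittleO.of_bound fun c hc => ?_
    filter_upwards [Metric.ball_mem_nhds (0 : ℝ) hc] with s hs
    rw [mem_ball_zero_iff] at hs
    rw [zero_add, posSq_of_nonpos le_rfl, smul_zero, sub_zero, sub_zero,
      Real.norm_of_nonneg (posSq_nonneg s)]
    have : posSq s ≤ ‖s‖ ^ 2 := by
      rw [posSq]
      have : max s 0 ≤ ‖s‖ := max_le (le_abs_self s) (norm_nonneg s)
      gcongr
    nlinarith [norm_nonneg s]
  · have : posSq =ᶠ[𝓝 r] fun s => s ^ 2 := by
      filter_upwards [Ioi_mem_nhds h] with s hs using posSq_of_nonneg (le_of_lt hs)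
    rw [max_eq_left h.le]
    simpa using (hasDerivAt_pow 2 r).congr_of_eventuallyEq this

theorem contDiff_posSq : ContDiff ℝ 1 posSq := by
  rw [contDiff_one_iff_deriv]
  refine ⟨fun r => (hasDerivAt_posSq r).differentiableAt, ?_⟩
  rw [show deriv posSq = fun r => 2 * max r 0 from funext fun r => (hasDerivAt_posSq r).deriv]
  fun_prop

/-- A monotone function that vanishes near `-∞` is dominated by a `C¹` one. -/
theorem Monotone.exists_contDiff_ge {G : ℝ → ℝ} (hG : Monotone G) (h0 : ∀ r, 0 ≤ G r) {R₀ : ℝ}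
    (hR₀ : ∀ r ≤ R₀ + 2, G r = 0) :
    ∃ Φ : ℝ → ℝ, ContDiff ℝ 1 Φ ∧ Monotone Φ ∧ (∀ r, 0 ≤ Φ r) ∧ (∀ r ≤ R₀, Φ r = 0) ∧
      ∀ r, G r ≤ Φ r := by
  -- Averaging `G` over `[r, r + 1]` gains one degree of regularity; `Φ` is `G` averaged twice.
  have hint : ∀ a b, IntervalIntegrable G volume a b := fun a b => hG.intervalIntegrable
  set H : ℝ → ℝ := fun r => ∫ s in r..r + 1, G s with hH
  have hHc : Continuous H := by
    have h1 : H = fun r => (∫ s in (0 : ℝ)..r + 1, G s) - ∫ s in (0 : ℝ)..r, G s := by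
      ext r
      rw [hH, intervalIntegral.integral_interval_sub_left (hint _ _) (hint _ _)]
    rw [h1]
    have h2 := intervalIntegral.continuous_primitive (μ := volume) hint 0
    exact (h2.comp (continuous_add_const 1)).sub h2
  have havg : ∀ F : ℝ → ℝ, Monotone F → ∀ r, F r ≤ ∫ s in r..r + 1, F s := fun F hF r => by
    have := intervalIntegral.integral_mono_on (by linarith : r ≤ r + 1)
      (intervalIntegrable_const (c := F r)) (hF.intervalIntegrable (μ := volume))
      fun s hs => hF hs.1
    simpa using this
  have hzero : ∀ F : ℝ → ℝ, ∀ a, (∀ r ≤ a + 1, F r = 0) → ∀ r ≤ a, ∫ s in r..r + 1, F s = 0 :=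
    fun F a hF r hr => by
      rw [intervalIntegral.integral_congr (g := fun _ => (0 : ℝ)) fun s hs => ?_]
      · simp
      · rw [uIcc_of_le (by linarith)] at hs
        exact hF s (by linarith [hs.2])
  have hmono : Monotone H := fun r r' hr => by
    have hsh : ∀ a, H a = ∫ s in (0 : ℝ)..1, G (s + a) := fun a => by
      rw [intervalIntegral.integral_comp_add_right, zero_add, add_comm]
    rw [hsh, hsh]
    refine intervalIntegral.integral_mono_on zero_le_one ?_ ?_ fun s _ => hG (by linarith)
    · exact Monotone.intervalIntegrable fun a b hab => hG (by linarith)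
    · exact Monotone.intervalIntegrable fun a b hab => hG (by linarith)
  have hHG : ∀ r, G r ≤ H r := havg G hG
  have hder : ∀ r, HasDerivAt (fun r => ∫ s in r..r + 1, H s) (H (r + 1) - H r) r := fun r => by
    have h1 : (fun r => ∫ s in r..r + 1, H s) =
        fun r => (∫ s in (0 : ℝ)..r + 1, H s) - ∫ s in (0 : ℝ)..r, H s := by
      ext r
      rw [intervalIntegral.integral_interval_sub_left (hHc.intervalIntegrable _ _)
        (hHc.intervalIntegrable _ _)]
    have h2 : ∀ b, HasDerivAt (fun b => ∫ s in (0 : ℝ)..b, H s) (H b) b := fun b =>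
      hHc.integral_hasStrictDerivAt 0 b |>.hasDerivAt
    rw [h1]
    exact ((h2 (r + 1)).comp_add_const r 1).sub (h2 r)
  refine ⟨fun r => ∫ s in r..r + 1, H s, ?_, ?_, fun r => ?_, ?_, fun r => ?_⟩
  · rw [contDiff_one_iff_deriv]
    refine ⟨fun r => (hder r).differentiableAt, ?_⟩
    rw [funext fun r => (hder r).deriv]
    fun_prop
  · refine monotone_of_deriv_nonneg (fun r => (hder r).differentiableAt) fun r => ?_
    rw [(hder r).deriv]
    exact sub_nonneg.2 (hmono (by linarith))
  · exact intervalIntegral.integral_nonneg (by linarith) fun s _ => (h0 s).trans (hHG s)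
  · refine hzero H R₀ (hzero G (R₀ + 1) fun r hr => hR₀ r (by linarith))
  · exact (hHG r).trans (havg H hmono r)

/-! ### Finite speed of propagation -/

theorem norm_gradient_of_hasFDerivAt {N : ℕ} {f : RN N → ℝ} {x : RN N} {L : RN N →L[ℝ] ℝ}
    (h : HasFDerivAt f L x) : ‖gradient f x‖ = ‖L‖ := by
  rw [gradient, h.fderiv, LinearIsometryEquiv.norm_map]

/-- Viscosity subsolutions of the local equation `u_t = K |Du|` with initial datum `u₀`. When the
nonlocal velocity is bounded by `K`, Slepčev subsolutions, and the opposites of Slepčev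
supersolutions, are of this kind. -/
def IsEikonalSubsolution {N : ℕ} (J : Set ℝ) (K : ℝ) (u₀ : RN N → ℝ) (u : RN N × ℝ → ℝ) : Prop :=
  UpperSemicontinuousOn u (cyl N J) ∧
  ∀ φ : RN N × ℝ → ℝ, ContDiffOn ℝ 1 φ (cyl N J) →
    ∀ (x : RN N) (t : ℝ), t ∈ J → IsMaxOn (fun p => u p - φ p) (cyl N J) (x, t) →
      (0 < t → derivWithin (fun s => φ (x, s)) J t ≤ K * ‖gradient (fun y => φ (y, t)) x‖) ∧
      (t = 0 → u (x, 0) ≤ u₀ x)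

namespace IsEikonalSubsolution

variable {N : ℕ} {J : Set ℝ} {T K : ℝ} {ρ : ℝ → ℝ} {u₀ : RN N → ℝ} {u : RN N × ℝ → ℝ}

theorem deriv_le (hu : IsEikonalSubsolution J K u₀ u) (hρ : IsTimeExhaustion J T ρ)
    {φ : RN N × ℝ → ℝ} (hφ : ContDiffOn ℝ 1 φ (cyl N J)) {x : RN N} {t a : ℝ}
    {L : RN N →L[ℝ] ℝ} (ht : t ∈ J) (hmax : IsMaxOn (fun p => u p - φ p) (cyl N J) (x, t))
    (h0 : 0 < t) (hd : HasDerivWithinAt (fun s => φ (x, s)) a J t)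
    (hg : HasFDerivAt (fun y => φ (y, t)) L x) : a ≤ K * ‖L‖ := by
  have := (hu.2 φ hφ x t ht hmax).1 h0
  rwa [hd.derivWithin (hρ.uniqueDiffOn t ht), norm_gradient_of_hasFDerivAt hg] at this

/-- A bound of the initial datum by `A + C (√(1 + |x - x₀|²) - 1)` propagates with speed `K`. No
growth condition on `u` is needed, since test functions may grow arbitrarily fast. -/
theorem le_barrier (hu : IsEikonalSubsolution J K u₀ u) (hρ : IsTimeExhaustion J T ρ) (hK : 0 ≤ K)
    {A C : ℝ} {x₀ : RN N} (hC : 0 ≤ C) (h0 : ∀ x, u₀ x ≤ A + C * softNorm (x - x₀)) {x₁ : RN N}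
    {t₁ : ℝ} (ht₁ : t₁ ∈ J) : u (x₁, t₁) ≤ A + C * (softNorm (x₁ - x₀) + K * t₁) := by
  have ht₁0 := hρ.nonneg t₁ ht₁
  suffices h : ∀ l : ℝ, 0 < l → u (x₁, t₁) ≤ A + C * (softNorm (x₁ - x₀) + K * t₁) + l * t₁ by
    refine le_of_forall_pos_le_add fun ε hε => (h (ε / (t₁ + 1)) (by positivity)).trans ?_
    gcongr
    rw [div_mul_eq_mul_div, div_le_iff₀ (by positivity)]
    nlinarith
  intro l hl
  -- `r` is nondecreasing in time at speed at least `K` and has compact sublevel sets; adding a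
  -- fast growing function of `r`, which vanishes at `(x₁, t₁)`, makes the barrier coercive.
  set r : RN N × ℝ → ℝ := fun p => softNorm (p.1 - x₀) + K * p.2 + posSq (ρ p.2 - ρ t₁) with hr
  set R₀ : ℝ := softNorm (x₁ - x₀) + K * t₁ with hR₀
  have hrR₀ : r (x₁, t₁) = R₀ := by simp [hr, hR₀, posSq]
  set k : ℝ → Set (RN N × ℝ) := fun R =>
    Metric.closedBall x₀ (R + 1) ×ˢ {t ∈ J | ρ t ≤ ρ t₁ + R + 1} with hk
  have hkc : ∀ R, IsCompact (k R) := fun R => hρ.isCompact_piece _ _ _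
  have hkS : ∀ R, k R ⊆ cyl N J := fun R => piece_subset_cyl _ _ _
  have hkmono : ∀ R R', R ≤ R' → k R ⊆ k R' := fun R R' h p hp =>
    ⟨Metric.closedBall_subset_closedBall (by linarith) hp.1, hp.2.1, by
      have := hp.2.2
      linarith⟩
  have hrk : ∀ p ∈ cyl N J, ∀ R, r p ≤ R → p ∈ k R := fun p hp R hpR => by
    have h1 := softNorm_nonneg (p.1 - x₀)
    have h2 := mul_nonneg hK (hρ.nonneg p.2 hp.2)
    have h3 := posSq_nonneg (ρ p.2 - ρ t₁)
    simp only [hr] at hpR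
    refine ⟨?_, hp.2, ?_⟩
    · rw [mem_closedBall_iff_norm]
      linarith [norm_le_softNorm_add_one (p.1 - x₀)]
    · have h4 : ρ p.2 - ρ t₁ ≤ posSq (ρ p.2 - ρ t₁) + 1 := by
        rw [posSq]
        nlinarith [le_max_left (ρ p.2 - ρ t₁) 0, sq_nonneg (max (ρ p.2 - ρ t₁) 0 - 1)]
      linarith
  have hbdd : ∀ R, BddAbove (insert 0 (u '' k R)) := fun R =>
    ((hu.1.mono (hkS R)).bddAbove_of_isCompact (hkc R)).insert 0
  set G : ℝ → ℝ := fun R => if R ≤ R₀ + 2 then 0 else sSup (insert 0 (u '' k R)) + max R 0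
    with hG
  have hsup0 : ∀ R, 0 ≤ sSup (insert 0 (u '' k R)) := fun R => le_csSup (hbdd R) (mem_insert _ _)
  have hG0 : ∀ R, 0 ≤ G R := fun R => by
    simp only [hG]
    split_ifs
    · exact le_rfl
    · exact add_nonneg (hsup0 R) (le_max_right _ _)
  have hGmono : Monotone G := fun R R' h => by
    by_cases h1 : R ≤ R₀ + 2
    · rw [show G R = 0 from if_pos h1]
      exact hG0 R'
    · simp only [hG, if_neg h1, if_neg (fun h' => h1 (h.trans h') : ¬ R' ≤ R₀ + 2)]
      refine add_le_add (csSup_le_csSup (hbdd R') (insert_nonempty _ _) ?_) (by gcongr)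
      exact insert_subset_insert (image_mono (hkmono R R' h))
  obtain ⟨Φ, hΦ1, hΦm, hΦ0, hΦz, hΦG⟩ :=
    hGmono.exists_contDiff_ge hG0 (R₀ := R₀) fun R hR => if_pos hR
  set φ : RN N × ℝ → ℝ := fun p =>
    A + C * (softNorm (p.1 - x₀) + K * p.2) + l * p.2 + Φ (r p) with hφ
  have hsn : ContDiffOn ℝ 1 (fun p : RN N × ℝ => softNorm (p.1 - x₀)) (cyl N J) :=
    (contDiff_softNorm.comp (contDiff_fst.sub contDiff_const)).contDiffOn
  have hrdiff : ContDiffOn ℝ 1 r (cyl N J) :=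
    (hsn.add (contDiff_const.mul contDiff_snd).contDiffOn).add
      (contDiff_posSq.comp_contDiffOn ((hρ.contDiffOn_snd N).sub contDiffOn_const))
  have hφdiff : ContDiffOn ℝ 1 φ (cyl N J) := by
    refine ((contDiffOn_const.add (contDiffOn_const.mul ?_)).add
      (contDiff_const.mul contDiff_snd).contDiffOn).add (hΦ1.comp_contDiffOn hrdiff)
    exact hsn.add (contDiff_const.mul contDiff_snd).contDiffOn
  have hp₁ : ((x₁, t₁) : RN N × ℝ) ∈ cyl N J := ⟨mem_univ _, ht₁⟩
  have husc : UpperSemicontinuousOn (fun p => u p - φ p) (cyl N J) :=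
    hu.1.sub_continuousOn hφdiff.continuousOn
  obtain ⟨⟨x, t⟩, ⟨-, ht⟩, hmax, hle⟩ := exists_isMaxOn_of_superlevel_subset husc hp₁
    (hkc (max (R₀ + 2) (-A - (u (x₁, t₁) - φ (x₁, t₁))))) (hkS _) fun p hp hle => by
      refine hrk p hp _ ?_
      by_contra! hlt
      obtain ⟨hlt1, hlt2⟩ := max_lt_iff.1 hlt
      have h1 : u p ≤ sSup (insert 0 (u '' k (r p))) :=
        le_csSup (hbdd _) (mem_insert_of_mem _ (mem_image_of_mem u (hrk p hp _ le_rfl)))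
      have h2 := hΦG (r p)
      simp only [hG, if_neg (not_le.2 hlt1)] at h2
      have h3 := le_max_left (r p) 0
      have h4 := mul_nonneg hC (add_nonneg (softNorm_nonneg (p.1 - x₀))
        (mul_nonneg hK (hρ.nonneg p.2 hp.2)))
      have h5 := mul_nonneg hl.le (hρ.nonneg p.2 hp.2)
      have h6 : φ p = A + C * (softNorm (p.1 - x₀) + K * p.2) + l * p.2 + Φ (r p) := rfl
      linarith
  have hval : φ (x₁, t₁) = A + C * (softNorm (x₁ - x₀) + K * t₁) + l * t₁ := by
    simp only [hφ, hrR₀, hΦz R₀ le_rfl, add_zero]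
  suffices h : u (x, t) - φ (x, t) ≤ 0 by
    rw [← hval]
    linarith
  have hdΦ : HasDerivAt Φ (deriv Φ (r (x, t))) (r (x, t)) :=
    (hΦ1.differentiable one_ne_zero _).hasDerivAt
  have hdΦ0 : 0 ≤ deriv Φ (r (x, t)) := hΦm.deriv_nonneg
  rcases eq_or_ne t 0 with rfl | htne
  · have h1 := (hu.2 φ hφdiff x 0 ht hmax).2 rfl
    have h2 : A + C * softNorm (x - x₀) ≤ φ (x, 0) := by
      simp only [hφ, mul_zero, add_zero]
      linarith [hΦ0 (r (x, 0))]
    linarith [h0 x]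
  · exfalso
    have hdt : HasDerivWithinAt (fun s => φ (x, s)) (C * K + l + deriv Φ (r (x, t)) *
        (K + 2 * max (ρ t - ρ t₁) 0 * derivWithin ρ J t)) J t := by
      have hid := hasDerivWithinAt_id t J
      have h1 : HasDerivWithinAt (fun s => r (x, s))
          (K + 2 * max (ρ t - ρ t₁) 0 * derivWithin ρ J t) J t := by
        refine HasDerivWithinAt.congr_deriv (((hid.const_mul K).const_add (softNorm (x - x₀))).add
          ((hasDerivAt_posSq _).comp_hasDerivWithinAt t
            ((hρ.hasDerivWithinAt ht).sub_const (ρ t₁)))) ?_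
        rw [mul_one]
      have h2 := hdΦ.comp_hasDerivWithinAt t h1
      have h3 := (((((hid.const_mul K).const_add (softNorm (x - x₀))).const_mul C).const_add A).add
        (hid.const_mul l)).add h2
      exact h3.congr_deriv (by ring)
    have hdx : HasFDerivAt (fun y => φ (y, t))
        ((C + deriv Φ (r (x, t))) • fderiv ℝ softNorm (x - x₀)) x := by
      have h1 := hasFDerivAt_softNorm_sub x₀ x
      have h2 : HasFDerivAt (fun y => softNorm (y - x₀) + K * t + posSq (ρ t - ρ t₁))
          (fderiv ℝ softNorm (x - x₀)) x :=
        (h1.add_const _).add_const _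
      have h3 := ((((h1.add_const (K * t)).const_mul C).const_add A).add_const (l * t)).add
        (hdΦ.comp_hasFDerivAt x h2)
      rw [add_smul]
      exact h3
    have h1 := hu.deriv_le hρ hφdiff ht hmax (hρ.pos ht htne) hdt hdx
    rw [norm_smul, Real.norm_of_nonneg (by positivity)] at h1
    have h2 : K * ((C + deriv Φ (r (x, t))) * ‖fderiv ℝ softNorm (x - x₀)‖)
        ≤ K * ((C + deriv Φ (r (x, t))) * 1) := by
      gcongr
      exact norm_fderiv_softNorm_le_one _
    have h3 : 0 ≤ deriv Φ (r (x, t)) * (2 * max (ρ t - ρ t₁) 0 * derivWithin ρ J t) :=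
      mul_nonneg hdΦ0 (mul_nonneg (by positivity) (hρ.derivWithin_nonneg t))
    nlinarith

theorem le_of_initial_le (hu : IsEikonalSubsolution J K u₀ u) (hρ : IsTimeExhaustion J T ρ)
    (hK : 0 ≤ K) {B : ℝ} (h0 : ∀ x, u₀ x ≤ B) {p : RN N × ℝ} (hp : p ∈ cyl N J) : u p ≤ B := by
  have := hu.le_barrier hρ hK (A := B) (C := 0) (x₀ := 0) le_rfl (by simpa using h0) (x₁ := p.1)
    hp.2
  simpa using this

set_option maxHeartbeats 1000000 in
/-- The bound `le_barrier`, started from a time `s ∈ J`. -/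
theorem le_barrier_from (hu : IsEikonalSubsolution J K u₀ u) (hρ : IsTimeExhaustion J T ρ)
    (hK : 0 ≤ K) {B : ℝ} (hB : ∀ p ∈ cyl N J, u p ≤ B) {A C s : ℝ} {x₀ : RN N} (hC : 0 ≤ C)
    (hs : s ∈ J) (h0 : ∀ x, u (x, s) ≤ A + C * softNorm (x - x₀)) {x₁ : RN N} {t₁ : ℝ}
    (ht₁ : t₁ ∈ J) (hst : s ≤ t₁) :
    u (x₁, t₁) ≤ A + C * (softNorm (x₁ - x₀) + K * (t₁ - s)) := by
  have hs0 := hρ.nonneg s hs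
  by_contra! hlt
  set g := u (x₁, t₁) - (A + C * (softNorm (x₁ - x₀) + K * (t₁ - s))) with hg
  have hg0 : 0 < g := sub_pos.2 hlt
  set w := softNorm (x₁ - x₀) + K * (t₁ - s) + (t₁ - s) + ρ t₁ with hw
  have hw0 : 0 ≤ w := by
    have h1 := softNorm_nonneg (x₁ - x₀)
    have h2 := hρ.weight_nonneg t₁ ht₁
    have h3 := mul_nonneg hK (sub_nonneg.2 hst)
    linarith
  obtain ⟨β, hβ, hβw⟩ : ∃ β, 0 < β ∧ β * w ≤ g / 2 := by
    refine ⟨g / 2 / (w + 1), by positivity, ?_⟩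
    rw [div_mul_eq_mul_div, div_le_iff₀ (by positivity)]
    nlinarith
  set ψ : RN N × ℝ → ℝ := fun p =>
    A + (C + β) * (softNorm (p.1 - x₀) + K * (p.2 - s)) + β * (p.2 - s) + β * ρ p.2 with hψ
  set Q := B - A + (C + β) * K * s + β * s with hQ
  have hψdiff : ContDiffOn ℝ 1 ψ (cyl N J) := by
    have hsn : ContDiffOn ℝ 1 (fun p : RN N × ℝ => softNorm (p.1 - x₀)) (cyl N J) :=
      (contDiff_softNorm.comp (contDiff_fst.sub contDiff_const)).contDiffOn
    have hsnd : ContDiffOn ℝ 1 (fun p : RN N × ℝ => p.2 - s) (cyl N J) :=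
      (contDiff_snd.sub contDiff_const).contDiffOn
    exact ((contDiffOn_const.add (contDiffOn_const.mul (hsn.add (contDiffOn_const.mul hsnd)))).add
      (contDiffOn_const.mul hsnd)).add (contDiffOn_const.mul (hρ.contDiffOn_snd N))
  have husc : ∀ φ : RN N × ℝ → ℝ, ContDiffOn ℝ 1 φ (cyl N J) →
      UpperSemicontinuousOn (fun p => u p - φ p) (cyl N J) := fun φ hφ =>
    hu.1.sub_continuousOn hφ.continuousOn
  set k := Metric.closedBall x₀ (Q / β + 1) ×ˢ {t ∈ J | ρ t ≤ Q / β} with hk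
  have hkc : IsCompact k := hρ.isCompact_piece _ _ _
  have hkS : k ⊆ cyl N J := piece_subset_cyl _ _ _
  have hval : g / 2 ≤ u (x₁, t₁) - ψ (x₁, t₁) := by
    have : u (x₁, t₁) - ψ (x₁, t₁) = g - β * w := by
      simp only [hg, hψ, hw]
      ring
    linarith
  have hlow : ∀ p ∈ cyl N J, ∀ e, 0 ≤ e → g / 2 ≤ u p - (ψ p + e) → p ∈ k ∧ e ≤ Q := by
    intro p hp e he h
    have h1 := hB p hp
    have h2 := hρ.nonneg p.2 hp.2
    have h3 := mul_nonneg (mul_nonneg (add_nonneg hC hβ.le) hK) h2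
    have h4 := mul_nonneg hC (softNorm_nonneg (p.1 - x₀))
    have h5 := mul_nonneg hβ.le (softNorm_nonneg (p.1 - x₀))
    have h6 := mul_nonneg hβ.le h2
    have h7 := mul_nonneg hβ.le (hρ.weight_nonneg p.2 hp.2)
    have h8 : β * softNorm (p.1 - x₀) + β * ρ p.2 + e ≤ Q := by
      simp only [hψ] at h
      simp only [hQ]
      nlinarith
    refine ⟨⟨?_, hp.2, (le_div_iff₀ hβ).2 (by linarith)⟩, by linarith⟩
    rw [mem_closedBall_iff_norm]
    have : softNorm (p.1 - x₀) ≤ Q / β := (le_div_iff₀ hβ).2 (by linarith)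
    linarith [norm_le_softNorm_add_one (p.1 - x₀)]
  -- On the compact set of points where `u - ψ ≥ g / 2` and `t ≤ s`, the time stays away from `s`.
  -- Hence a large multiple of `posSq (s - t)` keeps the maximum away from the times `t ≤ s`.
  have hDc : IsCompact ({p ∈ k | p.2 ≤ s} ∩ (fun p => u p - ψ p) ⁻¹' Ici (g / 2)) := by
    have h1 : IsCompact {p ∈ k | p.2 ≤ s} :=
      hkc.inter_right (isClosed_le continuous_snd continuous_const)
    exact UpperSemicontinuousOn.isCompact_inter_preimage_Ici
      ((husc ψ hψdiff).mono fun p hp => hkS hp.1) h1 _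
  obtain ⟨c, hc, hcD⟩ := hDc.exists_forall_le' (f := fun p => posSq (s - p.2)) (a := 0)
    (contDiff_posSq.continuous.comp (continuous_const.sub continuous_snd)).continuousOn
    (by
      rintro ⟨y, t⟩ ⟨⟨hyk, hts⟩, hyg⟩
      rw [posSq_of_nonneg (sub_nonneg.2 hts)]
      refine pow_pos (sub_pos.2 (lt_of_le_of_ne hts ?_)) 2
      rintro rfl
      have h1 := h0 y
      have h2 := mul_nonneg hβ.le (softNorm_nonneg (y - x₀))
      have h3 := mul_nonneg hβ.le (hρ.weight_nonneg t hs)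
      have h4 : g / 2 ≤ u (y, t) - ψ (y, t) := hyg
      simp only [hψ, sub_self, mul_zero, add_zero] at h4
      nlinarith)
  set n := max Q 0 / c + 1 with hn
  have hn0 : 0 < n := by positivity
  have hnc : Q < n * c := by
    rw [hn, add_mul, div_mul_cancel₀ _ hc.ne']
    linarith [le_max_left Q 0]
  set φ : RN N × ℝ → ℝ := fun p => ψ p + n * posSq (s - p.2) with hφ
  have hφdiff : ContDiffOn ℝ 1 φ (cyl N J) := hψdiff.add (contDiffOn_const.mul
    (contDiff_posSq.comp (contDiff_const.sub contDiff_snd)).contDiffOn)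
  have hval' : g / 2 ≤ u (x₁, t₁) - φ (x₁, t₁) := by
    simpa [hφ, posSq_of_nonpos (sub_nonpos.2 hst)] using hval
  have hn1 : ∀ p : RN N × ℝ, 0 ≤ n * posSq (s - p.2) := fun p =>
    mul_nonneg hn0.le (posSq_nonneg _)
  obtain ⟨⟨x, t⟩, ⟨-, ht⟩, hmax, hle⟩ := exists_isMaxOn_of_superlevel_subset (husc φ hφdiff)
    (show ((x₁, t₁) : RN N × ℝ) ∈ cyl N J from ⟨mem_univ _, ht₁⟩) hkc hkS fun p hp hle =>
      (hlow p hp _ (hn1 p) (hval'.trans hle)).1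
  have hge : g / 2 ≤ u (x, t) - (ψ (x, t) + n * posSq (s - t)) := hval'.trans hle
  have hxt := hlow (x, t) ⟨mem_univ _, ht⟩ (n * posSq (s - t)) (hn1 (x, t)) hge
  rcases le_or_gt t s with hts | hts
  · have h1 := hcD (x, t) ⟨⟨hxt.1, hts⟩, by
      have := hn1 (x, t)
      simp only [mem_preimage, mem_Ici]
      linarith⟩
    have h2 : n * c ≤ n * posSq (s - t) := by gcongr
    linarith [hxt.2]
  · have hdt : HasDerivWithinAt (fun τ => φ (x, τ))
        ((C + β) * K + β + β * derivWithin ρ J t) J t := by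
      have hid := (hasDerivWithinAt_id t J).sub_const s
      have h1 := (((((hid.const_mul K).const_add (softNorm (x - x₀))).const_mul (C + β)).const_add
        A).add (hid.const_mul β)).add ((hρ.hasDerivWithinAt ht).const_mul β)
      have h2 : HasDerivWithinAt (fun τ : ℝ => posSq (s - τ)) (2 * max (s - t) 0 * -1) J t :=
        (hasDerivAt_posSq (s - t)).comp_hasDerivWithinAt t ((hasDerivWithinAt_id t J).const_sub s)
      rw [max_eq_right (by linarith)] at h2
      exact (h1.add (h2.const_mul n)).congr_deriv (by ring)
    have hdx : HasFDerivAt (fun y => φ (y, t)) ((C + β) • fderiv ℝ softNorm (x - x₀)) x := by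
      have h1 := hasFDerivAt_softNorm_sub x₀ x
      exact (((((h1.add_const (K * (t - s))).const_mul (C + β)).const_add A).add_const
        (β * (t - s))).add_const (β * ρ t)).add_const (n * posSq (s - t))
    have h1 := hu.deriv_le hρ hφdiff ht hmax (by linarith) hdt hdx
    rw [norm_smul, Real.norm_of_nonneg (by positivity)] at h1
    have h2 : K * ((C + β) * ‖fderiv ℝ softNorm (x - x₀)‖) ≤ K * ((C + β) * 1) := by
      gcongr
      exact norm_fderiv_softNorm_le_one _
    have h3 := mul_nonneg hβ.le (hρ.derivWithin_nonneg t)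
    linarith

end IsEikonalSubsolution

/-! ### Integrals of a translated kernel over sets -/

section SetConv

variable {N : ℕ}

/-- The convolution `(f ⋆ 1_A)(x)` of an integrable kernel with the indicator of a set. -/
noncomputable def setConv (f : Lp ℝ 1 (volume : Measure (RN N))) (A : Set (RN N)) (x : RN N) : ℝ :=
  ∫ z, f (x - z) * A.indicator (fun _ => (1 : ℝ)) z

/-- The translate `z ↦ f (h + z)` of an integrable function. -/
noncomputable def shift (h : RN N) (f : Lp ℝ 1 (volume : Measure (RN N))) :
    Lp ℝ 1 (volume : Measure (RN N)) :=
  DomAddAct.mk h +ᵥ f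

theorem continuous_shift :
    Continuous fun q : RN N × Lp ℝ 1 (volume : Measure (RN N)) => shift q.1 q.2 := by
  have : Fact ((1 : ENNReal) ≠ ⊤) := ⟨ENNReal.one_ne_top⟩
  exact (DomAddAct.continuous_mk.comp continuous_fst).vadd continuous_snd

theorem shift_zero (f : Lp ℝ 1 (volume : Measure (RN N))) : shift 0 f = f := by
  rw [shift, DomAddAct.mk_zero, zero_vadd]

theorem coeFn_shift (h : RN N) (f : Lp ℝ 1 (volume : Measure (RN N))) :
    shift h f =ᵐ[volume] fun z => f (h + z) :=
  DomAddAct.vadd_Lp_ae_eq _ _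

theorem integrable_sub_left (f : Lp ℝ 1 (volume : Measure (RN N))) (x : RN N) :
    Integrable fun z => f (x - z) :=
  (L1.integrable_coeFn f).comp_sub_left x

theorem ae_comp_sub_left {P : RN N → Prop} (h : ∀ᵐ z, P z) (x : RN N) : ∀ᵐ z, P (x - z) :=
  (Measure.measurePreserving_sub_left volume x).quasiMeasurePreserving.ae h

theorem setConv_eq (f : Lp ℝ 1 (volume : Measure (RN N))) {A : Set (RN N)} (hA : MeasurableSet A)
    (x : RN N) : setConv f A x = ∫ z in A, f (x - z) := by
  rw [setConv, ← integral_indicator hA]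
  congr 1
  ext z
  by_cases hz : z ∈ A <;> simp [hz]

theorem abs_setConv_sub_le (f g : Lp ℝ 1 (volume : Measure (RN N))) {A : Set (RN N)}
    (hA : MeasurableSet A) (x : RN N) : |setConv f A x - setConv g A x| ≤ ‖f - g‖ := by
  have hf := integrable_sub_left f x
  have hg := integrable_sub_left g x
  rw [setConv_eq f hA, setConv_eq g hA, ← integral_sub hf.integrableOn hg.integrableOn]
  calc |∫ z in A, (f (x - z) - g (x - z))|
      ≤ ∫ z in A, |f (x - z) - g (x - z)| := abs_integral_le_integral_abs
    _ ≤ ∫ z, |f (x - z) - g (x - z)| :=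
        setIntegral_le_integral (hf.sub hg).abs (ae_of_all _ fun z => abs_nonneg _)
    _ = ∫ z, ‖(f - g) (x - z)‖ := by
        refine integral_congr_ae ?_
        filter_upwards [ae_comp_sub_left (Lp.coeFn_sub f g) x] with z hz
        rw [hz, Pi.sub_apply, Real.norm_eq_abs]
    _ = ‖f - g‖ := by
        rw [L1.norm_eq_integral_norm]
        exact integral_sub_left_eq_self (fun z => ‖(f - g) z‖) volume x

@[simp] theorem setConv_zero (A : Set (RN N)) (x : RN N) :
    setConv (0 : Lp ℝ 1 (volume : Measure (RN N))) A x = 0 := by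
  rw [setConv]
  refine integral_eq_zero_of_ae ?_
  filter_upwards [ae_comp_sub_left (Lp.coeFn_zero ℝ 1 volume) x] with z hz
  rw [hz, Pi.zero_apply, zero_mul, Pi.zero_apply]

theorem abs_setConv_le (f : Lp ℝ 1 (volume : Measure (RN N))) {A : Set (RN N)}
    (hA : MeasurableSet A) (x : RN N) : |setConv f A x| ≤ ‖f‖ := by
  simpa using abs_setConv_sub_le f 0 hA x

theorem setConv_add (f : Lp ℝ 1 (volume : Measure (RN N))) (A : Set (RN N)) (h x : RN N) :
    setConv f A (h + x) = setConv (shift h f) A x := by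
  refine integral_congr_ae ?_
  filter_upwards [ae_comp_sub_left (coeFn_shift h f) x] with z hz
  rw [hz, add_sub_assoc]

theorem setConv_preimage_add (f : Lp ℝ 1 (volume : Measure (RN N))) (A : Set (RN N)) (p x : RN N) :
    setConv f ((· + p) ⁻¹' A) x = setConv f A (x + p) := by
  have := integral_add_right_eq_self (μ := volume)
    (fun z => f (x + p - z) * A.indicator (fun _ => (1 : ℝ)) z) p
  rw [setConv, setConv, ← this]
  congr 1
  ext z
  rw [add_sub_add_right_eq_sub]
  rfl

theorem setConv_mono {f : Lp ℝ 1 (volume : Measure (RN N))} (hf : 0 ≤ f) {A B : Set (RN N)}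
    (hA : MeasurableSet A) (hB : MeasurableSet B) (hAB : A ⊆ B) (x : RN N) :
    setConv f A x ≤ setConv f B x := by
  rw [setConv_eq f hA, setConv_eq f hB]
  refine setIntegral_mono_set (integrable_sub_left f x).integrableOn ?_ hAB.eventuallyLE
  exact ae_restrict_of_ae (ae_comp_sub_left ((Lp.coeFn_nonneg f).2 hf) x)

theorem setConv_le_add {f : Lp ℝ 1 (volume : Measure (RN N))} (hf : 0 ≤ f) {A B C : Set (RN N)}
    (hA : MeasurableSet A) (hB : MeasurableSet B) (hC : MeasurableSet C) (h : A ⊆ B ∪ C)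
    (x : RN N) : setConv f A x ≤ setConv f B x + setConv f C x := by
  have hi := integrable_sub_left f x
  have h1 : setConv f (B ∪ C) x = setConv f B x + setConv f (C \ B) x := by
    rw [← union_sdiff_self, setConv_eq f (hB.union (hC.diff hB)), setConv_eq f hB,
      setConv_eq f (hC.diff hB), setIntegral_union disjoint_sdiff_right (hC.diff hB)
      hi.integrableOn hi.integrableOn]
  have h2 := setConv_mono hf hA (hB.union hC) h x
  have h3 := setConv_mono hf (hC.diff hB) hC sdiff_subset x
  linarith

/-- Continuity of `f ⋆ 1_A` with respect to the kernel, the set and the point. -/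
theorem tendsto_setConv {ι : Type*} {l : Filter ι} [l.IsCountablyGenerated]
    {F : ι → Lp ℝ 1 (volume : Measure (RN N))} {f : Lp ℝ 1 (volume : Measure (RN N))}
    {A : ι → Set (RN N)} {B : Set (RN N)} {X : ι → RN N} {x : RN N}
    (hA : ∀ i, MeasurableSet (A i)) (hF : Tendsto F l (𝓝 f)) (hX : Tendsto X l (𝓝 x))
    (h : ∀ z, ∀ᶠ i in l, z ∈ A i ↔ z ∈ B) :
    Tendsto (fun i => setConv (F i) (A i) (X i)) l (𝓝 (setConv f B x)) := by
  have h1 : Tendsto (fun i => setConv f (A i) x) l (𝓝 (setConv f B x)) := by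
    refine tendsto_integral_filter_of_dominated_convergence (fun z => |f (x - z)|)
      (Eventually.of_forall fun i => ?_) (Eventually.of_forall fun i => ae_of_all _ fun z => ?_)
      (integrable_sub_left f x).abs (ae_of_all _ fun z => ?_)
    · exact (integrable_sub_left f x).aestronglyMeasurable.mul
        (measurable_const.indicator (hA i)).aestronglyMeasurable
    · by_cases hz : z ∈ A i <;> simp [hz]
    · refine tendsto_const_nhds.congr' ?_
      filter_upwards [h z] with i hi
      by_cases hz : z ∈ B <;> simp [hz, hi]
  have h2 : Tendsto (fun i => ‖shift (X i - x) (F i) - f‖) l (𝓝 0) := by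
    have h3 : Tendsto (fun i => (X i - x, F i)) l (𝓝 ((0 : RN N), f)) := by
      rw [← sub_self x]
      exact (hX.sub_const x).prodMk_nhds hF
    have h4 := (continuous_shift.tendsto _).comp h3
    rw [shift_zero] at h4
    simpa using (h4.sub_const f).norm
  have h3 : Tendsto (fun i => setConv (F i) (A i) (X i) - setConv f (A i) x) l (𝓝 0) := by
    refine squeeze_zero_norm (fun i => ?_) h2
    have := setConv_add (F i) (A i) (X i - x) x
    rw [sub_add_cancel] at this
    rw [this, Real.norm_eq_abs]
    exact abs_setConv_sub_le _ _ (hA i) x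
  simpa using h3.add h1

/-- Upper semicontinuity of `f ⋆ 1_A` when the sets `A i` are asymptotically contained in `B`. -/
theorem eventually_setConv_lt {ι : Type*} {l : Filter ι} [l.IsCountablyGenerated]
    {F : ι → Lp ℝ 1 (volume : Measure (RN N))} {f : Lp ℝ 1 (volume : Measure (RN N))}
    {A : ι → Set (RN N)} {B : Set (RN N)} {X : ι → RN N} {x : RN N}
    (hA : ∀ i, MeasurableSet (A i)) (hB : MeasurableSet B) (hF0 : ∀ i, 0 ≤ F i)
    (hF : Tendsto F l (𝓝 f)) (hX : Tendsto X l (𝓝 x))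
    (h : ∀ z, z ∉ B → ∀ᶠ i in l, z ∉ A i) {c : ℝ} (hc : setConv f B x < c) :
    ∀ᶠ i in l, setConv (F i) (A i) (X i) < c := by
  have h1 := tendsto_setConv (A := fun i => A i ∪ B) (B := B) (fun i => (hA i).union hB) hF hX
    fun z => by
      by_cases hz : z ∈ B
      · simp [hz]
      · filter_upwards [h z hz] with i hi
        simp [hz, hi]
  filter_upwards [h1.eventually (gt_mem_nhds hc)] with i hi
  exact (setConv_mono (hF0 i) (hA i) ((hA i).union hB) subset_union_left _).trans_lt hi

/-- Lower semicontinuity of `f ⋆ 1_A` when the sets `A i` asymptotically contain `B`. -/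
theorem eventually_lt_setConv {ι : Type*} {l : Filter ι} [l.IsCountablyGenerated]
    {F : ι → Lp ℝ 1 (volume : Measure (RN N))} {f : Lp ℝ 1 (volume : Measure (RN N))}
    {A : ι → Set (RN N)} {B : Set (RN N)} {X : ι → RN N} {x : RN N}
    (hA : ∀ i, MeasurableSet (A i)) (hB : MeasurableSet B) (hF0 : ∀ i, 0 ≤ F i)
    (hF : Tendsto F l (𝓝 f)) (hX : Tendsto X l (𝓝 x))
    (h : ∀ z ∈ B, ∀ᶠ i in l, z ∈ A i) {c : ℝ} (hc : c < setConv f B x) :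
    ∀ᶠ i in l, c < setConv (F i) (A i) (X i) := by
  have h1 := tendsto_setConv (A := fun i => A i ∩ B) (B := B) (fun i => (hA i).inter hB) hF hX
    fun z => by
      by_cases hz : z ∈ B
      · filter_upwards [h z hz] with i hi
        simp [hz, hi]
      · simp [hz]
  filter_upwards [h1.eventually (lt_mem_nhds hc)] with i hi
  exact hi.trans_le (setConv_mono (hF0 i) ((hA i).inter hB) (hA i) inter_subset_left _)

theorem setConv_compl_closedBall (f : Lp ℝ 1 (volume : Measure (RN N))) (x : RN N) (R : ℝ) :
    setConv f (Metric.closedBall x R)ᶜ x = setConv f (Metric.closedBall 0 R)ᶜ 0 := by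
  have := setConv_preimage_add f (Metric.closedBall x R)ᶜ x 0
  rw [zero_add] at this
  rw [← this]
  congr 1
  ext z
  simp [dist_eq_norm]

/-- On a compact set of times, a continuous family of integrable kernels is uniformly tight and
uniformly continuous under translations. -/
theorem exists_tail_and_shift_le {k : Set ℝ} (hk : IsCompact k)
    {c₀ : ℝ → Lp ℝ 1 (volume : Measure (RN N))} (hc : ContinuousOn c₀ k) {e : ℝ} (he : 0 < e) :
    ∃ R δ : ℝ, 0 < δ ∧ ∀ t ∈ k, (∀ x R', R ≤ R' → 0 ≤ c₀ t →
        setConv (c₀ t) (Metric.closedBall x R')ᶜ x ≤ e) ∧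
      ∀ h : RN N, ‖h‖ ≤ δ → ‖shift h (c₀ t) - c₀ t‖ ≤ e := by
  have hms : ∀ R : ℝ, MeasurableSet (Metric.closedBall (0 : RN N) R)ᶜ := fun R =>
    Metric.isClosed_closedBall.measurableSet.compl
  refine hk.induction_on ⟨0, 1, one_pos, by simp⟩ ?_ ?_ ?_
  · rintro s t hst ⟨R, δ, hδ, h⟩
    exact ⟨R, δ, hδ, fun τ hτ => h τ (hst hτ)⟩
  · rintro s t ⟨R, δ, hδ, h⟩ ⟨R', δ', hδ', h'⟩
    refine ⟨max R R', min δ δ', lt_min hδ hδ', ?_⟩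
    rintro τ (hτ | hτ)
    · exact ⟨fun x r hr => (h τ hτ).1 x r ((le_max_left _ _).trans hr),
        fun v hv => (h τ hτ).2 v (hv.trans (min_le_left _ _))⟩
    · exact ⟨fun x r hr => (h' τ hτ).1 x r ((le_max_right _ _).trans hr),
        fun v hv => (h' τ hτ).2 v (hv.trans (min_le_right _ _))⟩
  · intro t ht
    have h1 : Tendsto (fun n : ℕ => setConv (c₀ t) (Metric.closedBall 0 (n : ℝ))ᶜ 0) atTop
        (𝓝 (setConv (c₀ t) ∅ 0)) := by
      refine tendsto_setConv (fun n => hms n) tendsto_const_nhds tendsto_const_nhds fun z => ?_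
      obtain ⟨n, hn⟩ := exists_nat_ge ‖z‖
      filter_upwards [eventually_ge_atTop n] with m hm
      have : ‖z‖ ≤ m := hn.trans (by exact_mod_cast hm)
      simp [this]
    have h0 : setConv (c₀ t) ∅ 0 = 0 := by simp [setConv]
    rw [h0] at h1
    obtain ⟨n, hn⟩ := (h1.eventually (gt_mem_nhds (half_pos he))).exists
    have h2 : Tendsto (fun q : RN N × ℝ => ‖shift q.1 (c₀ q.2) - c₀ q.2‖) (𝓝 0 ×ˢ 𝓝[k] t)
        (𝓝 0) := by
      have h3 : Tendsto (fun q : RN N × ℝ => c₀ q.2) (𝓝 0 ×ˢ 𝓝[k] t) (𝓝 (c₀ t)) :=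
        (hc t ht).tendsto.comp tendsto_snd
      have h4 : Tendsto (fun q : RN N × ℝ => (q.1, c₀ q.2)) (𝓝 0 ×ˢ 𝓝[k] t)
          (𝓝 ((0 : RN N), c₀ t)) := tendsto_fst.prodMk_nhds h3
      have h5 := (continuous_shift.tendsto _).comp h4
      rw [shift_zero] at h5
      simpa using (h5.sub h3).norm
    obtain ⟨P, hP, Q, hQ, hPQ⟩ := eventually_prod_iff.1 (h2.eventually (gt_mem_nhds he))
    obtain ⟨δ, hδ, hδP⟩ := Metric.eventually_nhds_iff.1 hP
    have h6 : ∀ᶠ s in 𝓝[k] t, ‖c₀ s - c₀ t‖ < e / 2 := by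
      have := ((hc t ht).sub_const (c₀ t)).norm
      simp only [sub_self, norm_zero] at this
      exact this.eventually (gt_mem_nhds (half_pos he))
    refine ⟨_, hQ.and h6, n, δ / 2, half_pos hδ, fun s hs => ⟨fun x R hR hs0 => ?_, fun h hh => ?_⟩⟩
    · have h7 := (abs_le.1 (abs_setConv_sub_le (c₀ s) (c₀ t) (hms n) 0)).2
      have h8 := setConv_mono hs0 (hms R) (hms n)
        (compl_subset_compl.2 (Metric.closedBall_subset_closedBall hR)) 0
      rw [setConv_compl_closedBall]
      linarith [hs.2]
    · refine (hPQ (hδP ?_) hs.1).le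
      rw [dist_zero_right]
      linarith

/-- If, near `x`, the set `A` translated by `p` lies in `B`, then `f ⋆ 1_A (x)` exceeds
`g ⋆ 1_B (y)` at most by the errors due to the tail of `f`, to the distance from `x + p` to `y`,
and to the difference between `f` and `g`. -/
theorem setConv_le_of_translate_subset {f g : Lp ℝ 1 (volume : Measure (RN N))} (hf : 0 ≤ f)
    {A B : Set (RN N)} (hA : MeasurableSet A) (hB : MeasurableSet B) {x y p : RN N} {R : ℝ}
    (h : ∀ z ∈ A, ‖z - x‖ ≤ R → z + p ∈ B) :
    setConv f A x ≤ setConv g B y + ‖f - g‖ + ‖shift (x + p - y) f - f‖ +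
      setConv f (Metric.closedBall x R)ᶜ x := by
  have h1 := setConv_le_add hf hA (measurable_add_const p hB)
    (Metric.isClosed_closedBall (x := x) (ε := R)).measurableSet.compl (fun z hz => by
      by_cases hzx : ‖z - x‖ ≤ R
      · exact Or.inl (h z hz hzx)
      · right
        rwa [mem_compl_iff, mem_closedBall_iff_norm]) x
  have h2 : setConv f ((· + p) ⁻¹' B) x = setConv (shift (x + p - y) f) B y := by
    rw [setConv_preimage_add, ← setConv_add, sub_add_cancel]
  have h3 := (abs_le.1 (abs_setConv_sub_le (shift (x + p - y) f) f hB y)).2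
  have h4 := (abs_le.1 (abs_setConv_sub_le f g hB y)).2
  linarith

end SetConv

/-! ### The nonlocal velocities -/

section Velocity

variable {N : ℕ} {J : Set ℝ} {T K : ℝ} {ρ : ℝ → ℝ} {c₀ : ℝ → Lp ℝ 1 (volume : Measure (RN N))}
  {c₁ : RN N × ℝ → ℝ} {u₀ : RN N → ℝ} {u v : RN N × ℝ → ℝ}

theorem cPlus_eq (x : RN N) (t : ℝ) :
    cPlus c₀ c₁ u x t = c₁ (x, t) + setConv (c₀ t) {y | u (x, t) ≤ u (y, t)} x := rfl

theorem cMinus_eq (x : RN N) (t : ℝ) :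
    cMinus c₀ c₁ u x t = c₁ (x, t) + setConv (c₀ t) {y | u (x, t) < u (y, t)} x := rfl

theorem UpperSemicontinuousOn.measurableSet_slice (hu : UpperSemicontinuousOn u (cyl N J)) {t : ℝ}
    (ht : t ∈ J) (a : ℝ) : MeasurableSet {y | a ≤ u (y, t)} := by
  have h : UpperSemicontinuousOn (u ∘ fun y : RN N => (y, t)) univ :=
    hu.comp (by fun_prop) fun y _ => ⟨mem_univ _, ht⟩
  exact ((upperSemicontinuousOn_univ_iff.1 h).isClosed_preimage a).measurableSet

theorem LowerSemicontinuousOn.measurableSet_slice (hu : LowerSemicontinuousOn u (cyl N J)) {t : ℝ}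
    (ht : t ∈ J) (a : ℝ) : MeasurableSet {y | a < u (y, t)} := by
  have h : LowerSemicontinuousOn (u ∘ fun y : RN N => (y, t)) univ :=
    hu.comp (by fun_prop) fun y _ => ⟨mem_univ _, ht⟩
  exact ((lowerSemicontinuousOn_univ_iff.1 h).isOpen_preimage a).measurableSet

/-- `K` bounds the nonlocal velocity, whatever the set of integration. -/
def IsSpeedBound (J : Set ℝ) (c₀ : ℝ → Lp ℝ 1 (volume : Measure (RN N))) (c₁ : RN N × ℝ → ℝ)
    (K : ℝ) : Prop :=
  ∀ x, ∀ t ∈ J, ∀ A : Set (RN N), MeasurableSet A → |c₁ (x, t) + setConv (c₀ t) A x| ≤ K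

theorem VelocityRegularity.exists_isSpeedBound (hc : VelocityRegularity J c₀ c₁) :
    ∃ K, 0 < K ∧ IsSpeedBound J c₀ c₁ K := by
  obtain ⟨M₀, h₀⟩ := hc.kernel_bounded
  obtain ⟨M₁, h₁⟩ := hc.force_bounded
  refine ⟨max (M₀ + M₁) 1, by positivity, fun x t ht A hA => le_max_of_le_left ?_⟩
  have := abs_setConv_le (c₀ t) hA x
  linarith [abs_add_le (c₁ (x, t)) (setConv (c₀ t) A x), h₀ t ht, h₁ x t ht]

theorem IsSlepcevSubsolution.deriv_le (hu : IsSlepcevSubsolution J c₀ c₁ u₀ u)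
    (hρ : IsTimeExhaustion J T ρ) {φ : RN N × ℝ → ℝ} (hφ : ContDiffOn ℝ 1 φ (cyl N J)) {x : RN N}
    {t a : ℝ} {L : RN N →L[ℝ] ℝ} (ht : t ∈ J)
    (hmax : IsMaxOn (fun p => u p - φ p) (cyl N J) (x, t)) (h0 : 0 < t)
    (hd : HasDerivWithinAt (fun s => φ (x, s)) a J t) (hg : HasFDerivAt (fun y => φ (y, t)) L x) :
    a ≤ cPlus c₀ c₁ u x t * ‖L‖ := by
  have := (hu.2 φ hφ x t ht hmax).1 h0
  rwa [hd.derivWithin (hρ.uniqueDiffOn t ht), norm_gradient_of_hasFDerivAt hg] at this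

theorem IsSlepcevSupersolution.le_deriv (hv : IsSlepcevSupersolution J c₀ c₁ u₀ v)
    (hρ : IsTimeExhaustion J T ρ) {φ : RN N × ℝ → ℝ} (hφ : ContDiffOn ℝ 1 φ (cyl N J)) {x : RN N}
    {t a : ℝ} {L : RN N →L[ℝ] ℝ} (ht : t ∈ J)
    (hmin : IsMinOn (fun p => v p - φ p) (cyl N J) (x, t)) (h0 : 0 < t)
    (hd : HasDerivWithinAt (fun s => φ (x, s)) a J t) (hg : HasFDerivAt (fun y => φ (y, t)) L x) :
    cMinus c₀ c₁ v x t * ‖L‖ ≤ a := by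
  have := (hv.2 φ hφ x t ht hmin).1 h0
  rwa [hd.derivWithin (hρ.uniqueDiffOn t ht), norm_gradient_of_hasFDerivAt hg] at this

theorem IsSlepcevSubsolution.isEikonalSubsolution (hu : IsSlepcevSubsolution J c₀ c₁ u₀ u)
    (hK : IsSpeedBound J c₀ c₁ K) : IsEikonalSubsolution J K u₀ u := by
  refine ⟨hu.1, fun φ hφ x t ht hmax => ⟨fun h0 => ?_, (hu.2 φ hφ x t ht hmax).2⟩⟩
  refine ((hu.2 φ hφ x t ht hmax).1 h0).trans ?_
  gcongr
  exact (abs_le.1 (hK x t ht _ (hu.1.measurableSet_slice ht _))).2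

theorem IsSlepcevSupersolution.isEikonalSubsolution_neg
    (hv : IsSlepcevSupersolution J c₀ c₁ u₀ v) (hK : IsSpeedBound J c₀ c₁ K) :
    IsEikonalSubsolution J K (fun x => -u₀ x) fun p => -v p := by
  refine ⟨fun p hp a ha => ?_, fun φ hφ x t ht hmax => ?_⟩
  · filter_upwards [hv.1 p hp (-a) (by linarith)] with q hq
    linarith
  have hmin : IsMinOn (fun p => v p - -φ p) (cyl N J) (x, t) := fun p hp => by
    have : -v p - φ p ≤ -v (x, t) - φ (x, t) := hmax hp
    change v (x, t) - -φ (x, t) ≤ v p - -φ p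
    linarith
  have h := hv.2 (fun p => -φ p) hφ.neg x t ht hmin
  refine ⟨fun h0 => ?_, fun h0 => neg_le_neg (h.2 h0)⟩
  have h1 := h.1 h0
  have h2 : gradient (fun y => -φ (y, t)) x = -gradient (fun y => φ (y, t)) x := by
    simp only [gradient, fderiv_fun_neg, map_neg]
  rw [derivWithin.fun_neg, h2, norm_neg] at h1
  have h3 := (abs_le.1 (hK x t ht _ (hv.1.measurableSet_slice ht (v (x, t))))).1
  have h4 := mul_le_mul_of_nonneg_right h3 (norm_nonneg (gradient (fun y => φ (y, t)) x))
  rw [cMinus_eq] at h1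
  linarith

end Velocity

/-! ### Comparison of subsolutions and supersolutions -/

section Comparison

variable {N : ℕ} {J : Set ℝ} {T K : ℝ} {ρ : ℝ → ℝ} {c₀ : ℝ → Lp ℝ 1 (volume : Measure (RN N))}
  {c₁ : RN N × ℝ → ℝ} {u₀ : RN N → ℝ} {u v : RN N × ℝ → ℝ}

/-- A subsolution stays below the initial datum up to a small error for a short time, uniformly in
space. -/
theorem IsEikonalSubsolution.exists_initial_layer (hu : IsEikonalSubsolution J K u₀ u)
    (hρ : IsTimeExhaustion J T ρ) (hK : 0 ≤ K) (hu₀ : UniformContinuous u₀)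
    (hb : ∃ B : ℝ, ∀ x, |u₀ x| ≤ B) {e : ℝ} (he : 0 < e) :
    ∃ δ, 0 < δ ∧ ∀ t ∈ J, t ≤ δ → ∀ x, u (x, t) ≤ u₀ x + e := by
  obtain ⟨C, hC, hmod⟩ := hu₀.exists_softNorm_modulus hb (half_pos he)
  refine ⟨e / 2 / (C * K + 1), by positivity, fun t ht htδ x => ?_⟩
  have h1 := hu.le_barrier hρ hK (A := u₀ x + e / 2) hC (x₀ := x)
    (fun y => by linarith [hmod y x]) (x₁ := x) ht
  rw [le_div_iff₀ (by positivity)] at htδ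
  simp only [sub_self, softNorm_zero, zero_add] at h1
  nlinarith [hρ.nonneg t ht]

/-- The penalization of the doubling of variables. The exponential, of rate `γ`, absorbs the
Lipschitz constant of the driving force; `α` and `β` make the maximum attained, and the term
`β * p.2` makes the viscosity inequality strict; `n` forces the two times together. -/
noncomputable def doublingPenalty (ρ : ℝ → ℝ) (C γ α β n : ℝ) (p q : RN N × ℝ) : ℝ :=
  C * Real.exp (γ * p.2) * softNorm (p.1 - q.1) + α * softNorm p.1 + β * p.2 + β * ρ p.2 +
    β * ρ q.2 + n * (p.2 - q.2) ^ 2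

theorem contDiffOn_doublingPenalty_left (hρ : IsTimeExhaustion J T ρ) (C γ α β n : ℝ)
    (q : RN N × ℝ) : ContDiffOn ℝ 1 (fun p => doublingPenalty ρ C γ α β n p q) (cyl N J) := by
  have h1 : ContDiff ℝ 1 fun p : RN N × ℝ => softNorm (p.1 - q.1) :=
    contDiff_softNorm.comp (contDiff_fst.sub contDiff_const)
  have h2 : ContDiff ℝ 1 fun p : RN N × ℝ => softNorm p.1 := contDiff_softNorm.comp contDiff_fst
  have h3 : ContDiff ℝ 1 fun p : RN N × ℝ => C * Real.exp (γ * p.2) := by fun_prop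
  have h4 : ContDiff ℝ 1 fun p : RN N × ℝ => n * (p.2 - q.2) ^ 2 := by fun_prop
  exact (((((h3.mul h1).add (contDiff_const.mul h2)).add
    (contDiff_const.mul contDiff_snd)).contDiffOn.add
    (contDiffOn_const.mul (hρ.contDiffOn_snd N))).add contDiffOn_const).add h4.contDiffOn

theorem contDiffOn_doublingPenalty_right (hρ : IsTimeExhaustion J T ρ) (C γ α β n : ℝ)
    (p : RN N × ℝ) : ContDiffOn ℝ 1 (fun q => -doublingPenalty ρ C γ α β n p q) (cyl N J) := by
  have h1 : ContDiff ℝ 1 fun q : RN N × ℝ => softNorm (p.1 - q.1) :=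
    contDiff_softNorm.comp (contDiff_const.sub contDiff_fst)
  have h4 : ContDiff ℝ 1 fun q : RN N × ℝ => n * (p.2 - q.2) ^ 2 := by fun_prop
  exact ((((((contDiff_const.mul h1).add contDiff_const).add contDiff_const).add
    contDiff_const).contDiffOn.add (contDiffOn_const.mul (hρ.contDiffOn_snd N))).add
    h4.contDiffOn).neg

theorem continuousOn_doublingPenalty (hρ : IsTimeExhaustion J T ρ) (C γ α β n : ℝ) :
    ContinuousOn (fun P : (RN N × ℝ) × (RN N × ℝ) => doublingPenalty ρ C γ α β n P.1 P.2)
      (cyl N J ×ˢ cyl N J) := by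
  have h1 : Continuous fun P : (RN N × ℝ) × (RN N × ℝ) => softNorm (P.1.1 - P.2.1) :=
    continuous_softNorm.comp (by fun_prop)
  have h2 : Continuous fun P : (RN N × ℝ) × (RN N × ℝ) => softNorm P.1.1 :=
    continuous_softNorm.comp (by fun_prop)
  have h3 : ContinuousOn (fun P : (RN N × ℝ) × (RN N × ℝ) => ρ P.1.2) (cyl N J ×ˢ cyl N J) :=
    hρ.contDiffOn.continuousOn.comp (by fun_prop) fun P hP => hP.1.2
  have h4 : ContinuousOn (fun P : (RN N × ℝ) × (RN N × ℝ) => ρ P.2.2) (cyl N J ×ˢ cyl N J) :=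
    hρ.contDiffOn.continuousOn.comp (by fun_prop) fun P hP => hP.2.2
  have h5 : Continuous fun P : (RN N × ℝ) × (RN N × ℝ) => C * Real.exp (γ * P.1.2) := by fun_prop
  have h6 : Continuous fun P : (RN N × ℝ) × (RN N × ℝ) => β * P.1.2 := by fun_prop
  have h7 : Continuous fun P : (RN N × ℝ) × (RN N × ℝ) => n * (P.1.2 - P.2.2) ^ 2 := by fun_prop
  exact ((((((h5.mul h1).add (continuous_const.mul h2)).add h6).continuousOn.add
    (continuousOn_const.mul h3)).add (continuousOn_const.mul h4))).add h7.continuousOn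

/-- The two viscosity inequalities at a maximum point of the doubled functional, subtracted from
each other. -/
theorem deriv_le_of_isMaxOn_doubling (hρ : IsTimeExhaustion J T ρ)
    (hu : IsSlepcevSubsolution J c₀ c₁ u₀ u) (hv : IsSlepcevSupersolution J c₀ c₁ u₀ v)
    (hK : IsSpeedBound J c₀ c₁ K) {C γ α β n : ℝ} (hC : 0 ≤ C) (hα : 0 ≤ α) (hβ : 0 ≤ β)
    {x y : RN N} {t s : ℝ} (ht : t ∈ J) (hs : s ∈ J) (ht0 : 0 < t) (hs0 : 0 < s)
    (hmax : ∀ p ∈ cyl N J, ∀ q ∈ cyl N J, u p - v q - doublingPenalty ρ C γ α β n p q ≤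
      u (x, t) - v (y, s) - doublingPenalty ρ C γ α β n (x, t) (y, s)) :
    γ * (C * Real.exp (γ * t)) * softNorm (x - y) + β ≤
      (cPlus c₀ c₁ u x t - cMinus c₀ c₁ v y s) *
        (C * Real.exp (γ * t) * ‖fderiv ℝ softNorm (x - y)‖) + K * α := by
  have hx : ((x, t) : RN N × ℝ) ∈ cyl N J := ⟨mem_univ _, ht⟩
  have hy : ((y, s) : RN N × ℝ) ∈ cyl N J := ⟨mem_univ _, hs⟩
  set E := C * Real.exp (γ * t) with hE
  have hE0 : 0 ≤ E := by positivity
  have h1 : γ * E * softNorm (x - y) + β + β * derivWithin ρ J t + n * (2 * (t - s)) ≤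
      cPlus c₀ c₁ u x t * ‖E • fderiv ℝ softNorm (x - y) + α • fderiv ℝ softNorm x‖ := by
    refine hu.deriv_le hρ (contDiffOn_doublingPenalty_left hρ C γ α β n (y, s)) ht
      (fun p hp => ?_) ht0 ?_ ?_
    · have := hmax p hp (y, s) hy
      change u p - doublingPenalty ρ C γ α β n p (y, s) ≤
        u (x, t) - doublingPenalty ρ C γ α β n (x, t) (y, s)
      linarith
    · have hid := hasDerivAt_id t
      have hexp : HasDerivAt (fun τ => C * Real.exp (γ * τ)) (γ * E) t :=
        ((hid.const_mul γ).exp.const_mul C).congr_deriv (by simp only [hE, id]; ring)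
      have hsq : HasDerivAt (fun τ => n * (τ - s) ^ 2) (n * (2 * (t - s))) t :=
        (((hid.sub_const s).pow 2).const_mul n).congr_deriv (by simp)
      have h := (((((hexp.mul_const (softNorm (x - y))).add_const (α * softNorm x)).add
        (hid.const_mul β)).hasDerivWithinAt.add ((hρ.hasDerivWithinAt ht).const_mul β)).add_const
        (β * ρ s)).add hsq.hasDerivWithinAt
      exact h.congr_deriv (by ring)
    · exact (((((hasFDerivAt_softNorm_sub y x).const_mul E).add
        ((hasFDerivAt_softNorm x).const_mul α)).add_const (β * t)).add_const (β * ρ t)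
        |>.add_const (β * ρ s)).add_const (n * (t - s) ^ 2)
  have h2 : cMinus c₀ c₁ v y s * ‖-(E • fderiv ℝ softNorm (y - x))‖ ≤
      -(β * derivWithin ρ J s + n * (2 * (t - s) * -1)) := by
    refine hv.le_deriv hρ (contDiffOn_doublingPenalty_right hρ C γ α β n (x, t)) hs
      (fun q hq => ?_) hs0 ?_ ?_
    · have := hmax (x, t) hx q hq
      change v (y, s) - -doublingPenalty ρ C γ α β n (x, t) (y, s) ≤
        v q - -doublingPenalty ρ C γ α β n (x, t) q
      linarith
    · have hsq : HasDerivAt (fun τ => n * (t - τ) ^ 2) (n * (2 * (t - s) * -1)) s :=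
        ((((hasDerivAt_id s).const_sub t).pow 2).const_mul n).congr_deriv (by simp)
      exact ((((hρ.hasDerivWithinAt hs).const_mul β).const_add (E * softNorm (x - y) +
        α * softNorm x + β * t + β * ρ t)).add hsq.hasDerivWithinAt).neg
    · have h := ((((((hasFDerivAt_softNorm_sub x y).const_mul E).add_const
        (α * softNorm x)).add_const (β * t)).add_const (β * ρ t)
        |>.add_const (β * ρ s)).add_const (n * (t - s) ^ 2)).neg
      refine h.congr_of_eventuallyEq (Eventually.of_forall fun z => ?_)
      simp only [doublingPenalty, softNorm_sub_comm x z, hE, Pi.neg_apply]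
  have h3 : ‖-(E • fderiv ℝ softNorm (y - x))‖ = E * ‖fderiv ℝ softNorm (x - y)‖ := by
    rw [norm_neg, norm_smul, Real.norm_of_nonneg hE0, norm_fderiv_softNorm, norm_fderiv_softNorm,
      norm_sub_rev]
  rw [h3] at h2
  set a := E • fderiv ℝ softNorm (x - y) with ha
  set b := α • fderiv ℝ softNorm x with hb
  have ha' : ‖a‖ = E * ‖fderiv ℝ softNorm (x - y)‖ := by
    rw [ha, norm_smul, Real.norm_of_nonneg hE0]
  have hb' : ‖b‖ ≤ α := by
    rw [hb, norm_smul, Real.norm_of_nonneg hα]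
    exact mul_le_of_le_one_right hα (norm_fderiv_softNorm_le_one x)
  have hcb : |cPlus c₀ c₁ u x t| ≤ K := hK x t ht _ (hu.1.measurableSet_slice ht _)
  have h4 : cPlus c₀ c₁ u x t * (‖a + b‖ - ‖a‖) ≤ K * α := by
    have h5 : |‖a + b‖ - ‖a‖| ≤ α := by
      have := abs_norm_sub_norm_le (a + b) a
      rw [add_sub_cancel_left] at this
      exact this.trans hb'
    calc cPlus c₀ c₁ u x t * (‖a + b‖ - ‖a‖) ≤ |cPlus c₀ c₁ u x t| * |‖a + b‖ - ‖a‖| := by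
          rw [← abs_mul]
          exact le_abs_self _
      _ ≤ K * α := by
          gcongr
          exact (abs_nonneg _).trans hcb
  have h5 := mul_nonneg hβ (hρ.derivWithin_nonneg t)
  have h6 := mul_nonneg hβ (hρ.derivWithin_nonneg s)
  rw [ha'] at h4
  linarith

/-- Inclusion of superlevel sets at a maximum point of the doubled functional. Translating by a
vector slightly shorter than `y - x` makes the penalty decrease, which turns the large inequality
for `u` into a strict one for `v`. -/
theorem lt_of_isMaxOn_doubling (hρ : IsTimeExhaustion J T ρ) {C γ α β n : ℝ} (hC : 0 ≤ C)
    (hγ : 0 ≤ γ) (hα : 0 ≤ α) {x y z : RN N} {t s θ : ℝ} (ht : t ∈ J) (hs : s ∈ J) (hθ0 : 0 ≤ θ)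
    (hθ1 : θ ≤ 1)
    (hmax : ∀ p ∈ cyl N J, ∀ q ∈ cyl N J, u p - v q - doublingPenalty ρ C γ α β n p q ≤
      u (x, t) - v (y, s) - doublingPenalty ρ C γ α β n (x, t) (y, s))
    (hz : u (x, t) ≤ u (z, t)) (hzx : α * ‖z - x‖ < C * θ * softNorm (x - y)) :
    v (y, s) < v (z + (1 - θ) • (y - x), s) := by
  have h1 := hmax (z, t) ⟨mem_univ _, ht⟩ (z + (1 - θ) • (y - x), s) ⟨mem_univ _, hs⟩
  have h2 : z - (z + (1 - θ) • (y - x)) = (1 - θ) • (x - y) := by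
    rw [← neg_sub x y, smul_neg]
    abel
  simp only [doublingPenalty, h2] at h1
  have h3 := softNorm_smul_le (sub_nonneg.2 hθ1) (by linarith) (x - y)
  have h4 : C ≤ C * Real.exp (γ * t) :=
    le_mul_of_one_le_right hC (Real.one_le_exp (mul_nonneg hγ (hρ.nonneg t ht)))
  have h5 := mul_le_mul_of_nonneg_left h3 (hC.trans h4)
  have h6 := mul_le_mul_of_nonneg_right h4 (mul_nonneg hθ0 (softNorm_nonneg (x - y)))
  have h7 := mul_le_mul_of_nonneg_left (softNorm_sub_softNorm_le z x) hα
  linarith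

set_option maxHeartbeats 2000000 in
/-- The estimate behind comparison and spatial regularity: a modulus of continuity of the initial
datum controls the difference of a subsolution and a supersolution at later times. -/
theorem sub_le_modulus (hρ : IsTimeExhaustion J T ρ) (hc₀ : ∀ t ∈ J, 0 ≤ c₀ t)
    (hc : VelocityRegularity J c₀ c₁) (hu₀ : UniformContinuous u₀)
    (hb : ∃ B : ℝ, ∀ x, |u₀ x| ≤ B) (hu : IsSlepcevSubsolution J c₀ c₁ u₀ u)
    (hv : IsSlepcevSupersolution J c₀ c₁ u₀ v) {L : ℝ} (hL : 0 ≤ L)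
    (hLip : ∀ x y, ∀ t ∈ J, |c₁ (x, t) - c₁ (y, t)| ≤ L * ‖x - y‖) {m C : ℝ} (hm : 0 ≤ m)
    (hC : 0 < C) (hmod : ∀ x y, u₀ x - u₀ y ≤ m + C * softNorm (x - y)) (x₁ y₁ : RN N) {t₁ : ℝ}
    (ht₁ : t₁ ∈ J) :
    u (x₁, t₁) - v (y₁, t₁) ≤ m + C * Real.exp (2 * L * t₁) * softNorm (x₁ - y₁) := by
  obtain ⟨K, hK0, hK⟩ := hc.exists_isSpeedBound
  have hue := hu.isEikonalSubsolution hK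
  have hve := hv.isEikonalSubsolution_neg hK
  obtain ⟨B, hB⟩ := hb
  have hB0 : 0 ≤ B := (abs_nonneg _).trans (hB 0)
  have huB : ∀ p ∈ cyl N J, u p ≤ B := fun p hp =>
    hue.le_of_initial_le hρ hK0.le (fun x => (abs_le.1 (hB x)).2) hp
  have hvB : ∀ p ∈ cyl N J, -v p ≤ B := fun p hp =>
    hve.le_of_initial_le hρ hK0.le (fun x => by linarith [(abs_le.1 (hB x)).1]) hp
  by_contra! hlt
  set γ := 2 * L with hγ
  have hγ0 : 0 ≤ γ := by positivity
  obtain ⟨g, hg, hgval⟩ : ∃ g, 0 < g ∧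
      m + C * Real.exp (γ * t₁) * softNorm (x₁ - y₁) + g ≤ u (x₁, t₁) - v (y₁, t₁) :=
    ⟨_, sub_pos.2 hlt, by linarith⟩
  -- The constants are fixed in the order `β`, `d`, `e`, `θ`, `α`, `n`: each may depend on the
  -- previous ones. If the derivative of `softNorm` at `x - y` has norm at least `d`, then `x` and
  -- `y` are so far apart that the gain `κ` of the shortened translation beats the variation of the
  -- `α` term on the ball of radius `R'`, outside of which the kernel is negligible.
  have ht₁0 := hρ.nonneg t₁ ht₁
  have hρt₁ := hρ.weight_nonneg t₁ ht₁
  obtain ⟨β, hβ, hβt⟩ : ∃ β, 0 < β ∧ β * (t₁ + 2 * ρ t₁) ≤ g / 4 := by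
    refine ⟨g / 4 / (t₁ + 2 * ρ t₁ + 1), by positivity, ?_⟩
    rw [div_mul_eq_mul_div, div_le_iff₀ (by positivity)]
    nlinarith
  have hT0 : 0 ≤ T := ht₁0.trans (hρ.le t₁ ht₁)
  set Em := C * Real.exp (γ * T) with hEm
  have hEm0 : 0 < Em := by positivity
  set d := β / (8 * K * Em) with hd
  have hd0 : 0 < d := by positivity
  set e := β / (16 * Em) with he
  have he0 : 0 < e := by positivity
  set r := 2 * B / β with hr
  set k := {t ∈ J | ρ t ≤ r} with hk
  have hkc : IsCompact k := hρ.isCompact_sublevel r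
  have hkJ : k ⊆ J := fun t ht => ht.1
  obtain ⟨R, δ, hδ, hRδ⟩ := exists_tail_and_shift_le hkc (hc.kernel_continuous.mono hkJ) he0
  set P := 2 * B / C + 1 with hP
  have hP0 : 0 < P := by positivity
  set θ := min 1 (δ / P) with hθ
  have hθ0 : 0 < θ := lt_min one_pos (by positivity)
  have hθ1 : θ ≤ 1 := min_le_left _ _
  have hθP : θ * P ≤ δ := (le_div_iff₀ hP0).1 (min_le_right _ _)
  set κ := C * θ * (d ^ 2 / 2) with hκ
  have hκ0 : 0 < κ := by positivity
  set R' := max R 0 with hR'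
  have hR'0 : 0 ≤ R' := le_max_right _ _
  -- `α`, which penalizes the space variable, is small with respect to all the previous constants.
  obtain ⟨α, hα, hα1, hα2, hα3⟩ : ∃ α, 0 < α ∧ α * softNorm x₁ ≤ g / 4 ∧ K * α ≤ β / 4 ∧
      α * R' < κ := by
    have hx₁ := softNorm_nonneg x₁
    have hS : 0 < softNorm x₁ + K + R' := by positivity
    set μ := min (g / 4) (min (β / 4) (κ / 2)) with hμ
    have hμ0 : 0 < μ := lt_min (by positivity) (lt_min (by positivity) (by positivity))
    have hα0 : 0 < μ / (softNorm x₁ + K + R') := by positivity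
    have hαS : μ / (softNorm x₁ + K + R') * (softNorm x₁ + K + R') = μ := div_mul_cancel₀ _ hS.ne'
    have h1 : μ ≤ g / 4 := min_le_left _ _
    have h2 : μ ≤ β / 4 := (min_le_right _ _).trans (min_le_left _ _)
    have h3 : μ ≤ κ / 2 := (min_le_right _ _).trans (min_le_right _ _)
    generalize μ / (softNorm x₁ + K + R') = α at hα0 hαS
    have h4 := mul_nonneg hα0.le hx₁
    have h5 := mul_nonneg hα0.le hK0.le
    have h6 := mul_nonneg hα0.le hR'0
    exact ⟨α, hα0, by linarith, by linarith, by linarith⟩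
  set X := 2 * B / α + 1 with hX
  have hQc : IsCompact (Metric.closedBall (0 : RN N) X ×ˢ k) := hρ.isCompact_piece 0 X r
  obtain ⟨δ₁, hδ₁, hc₁u⟩ := Metric.uniformContinuousOn_iff.1
    (hQc.uniformContinuousOn_of_continuous (hc.force_continuous.mono (piece_subset_cyl _ _ _))) e
    he0
  obtain ⟨δ₂, hδ₂, hc₀u⟩ := Metric.uniformContinuousOn_iff.1
    (hkc.uniformContinuousOn_of_continuous (hc.kernel_continuous.mono hkJ)) e he0
  obtain ⟨δ₃, hδ₃, hlu⟩ := hue.exists_initial_layer hρ hK0.le hu₀ ⟨B, hB⟩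
    (by positivity : 0 < g / 8)
  obtain ⟨δ₄, hδ₄, hlv⟩ := hve.exists_initial_layer hρ hK0.le hu₀.neg
    ⟨B, fun x => by simpa using hB x⟩ (by positivity : 0 < g / 8)
  set δ₀ := min (min δ₁ δ₂) (min δ₃ δ₄) with hδ₀
  have hδ₀0 : 0 < δ₀ := lt_min (lt_min hδ₁ hδ₂) (lt_min hδ₃ hδ₄)
  set n := (2 * B + 1) / δ₀ ^ 2 with hn
  have hn0 : 0 < n := by positivity
  set F : (RN N × ℝ) × (RN N × ℝ) → ℝ := fun P =>
    u P.1 - v P.2 - doublingPenalty ρ C γ α β n P.1 P.2 with hF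
  have hFusc : UpperSemicontinuousOn F (cyl N J ×ˢ cyl N J) := by
    refine UpperSemicontinuousOn.sub_continuousOn ?_ (continuousOn_doublingPenalty hρ C γ α β n)
    have h1 : UpperSemicontinuousOn (u ∘ Prod.fst) (cyl N J ×ˢ cyl N J) :=
      hu.1.comp continuousOn_fst fun P hP => hP.1
    have h2 : UpperSemicontinuousOn ((fun p => -v p) ∘ Prod.snd) (cyl N J ×ˢ cyl N J) :=
      hve.1.comp continuousOn_snd fun P hP => hP.2
    have h3 := h1.add h2
    have h4 : (fun P : (RN N × ℝ) × (RN N × ℝ) => u P.1 - v P.2) =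
      fun P => (u ∘ Prod.fst) P + ((fun p => -v p) ∘ Prod.snd) P := funext fun P =>
        sub_eq_add_neg _ _
    rw [h4]
    exact h3
  have hF₁ : m + g / 2 ≤ F ((x₁, t₁), (y₁, t₁)) := by
    simp only [hF, doublingPenalty, sub_self]
    linarith
  have hbound : ∀ P ∈ cyl N J ×ˢ cyl N J, m + g / 2 ≤ F P →
      C * softNorm (P.1.1 - P.2.1) ≤ 2 * B ∧ α * softNorm P.1.1 ≤ 2 * B ∧
      β * ρ P.1.2 ≤ 2 * B ∧ β * ρ P.2.2 ≤ 2 * B ∧ n * (P.1.2 - P.2.2) ^ 2 ≤ 2 * B ∧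
      m + g / 2 + C * softNorm (P.1.1 - P.2.1) ≤ u P.1 - v P.2 := by
    rintro ⟨⟨x, t⟩, ⟨y, s⟩⟩ ⟨⟨-, ht⟩, ⟨-, hs⟩⟩ h
    simp only [hF, doublingPenalty] at h ⊢
    change t ∈ J at ht
    change s ∈ J at hs
    have h1 := huB (x, t) ⟨mem_univ _, ht⟩
    have h2 := hvB (y, s) ⟨mem_univ _, hs⟩
    have h3 := mul_nonneg hC.le (softNorm_nonneg (x - y))
    have h4 := mul_nonneg hα.le (softNorm_nonneg x)
    have h5 := mul_nonneg hβ.le (hρ.nonneg t ht)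
    have h6 := mul_nonneg hβ.le (hρ.weight_nonneg t ht)
    have h7 := mul_nonneg hβ.le (hρ.weight_nonneg s hs)
    have h8 := mul_nonneg hn0.le (sq_nonneg (t - s))
    have h9 : C * softNorm (x - y) ≤ C * Real.exp (γ * t) * softNorm (x - y) := by
      gcongr
      · exact softNorm_nonneg _
      · exact le_mul_of_one_le_right hC.le (Real.one_le_exp (mul_nonneg hγ0 (hρ.nonneg t ht)))
    refine ⟨?_, ?_, ?_, ?_, ?_, ?_⟩ <;> linarith
  have hnorm : ∀ a z : ℝ, ∀ w : RN N, 0 < a → a * softNorm w ≤ z → ‖w‖ ≤ z / a + 1 :=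
    fun a z w ha h => by
      have : softNorm w ≤ z / a := (le_div_iff₀ ha).2 (by linarith)
      linarith [norm_le_softNorm_add_one w]
  obtain ⟨⟨⟨x, t⟩, ⟨y, s⟩⟩, ⟨⟨-, ht⟩, ⟨-, hs⟩⟩, hmax, hle⟩ := exists_isMaxOn_of_superlevel_subset
    hFusc (p₀ := ((x₁, t₁), (y₁, t₁))) ⟨⟨mem_univ _, ht₁⟩, ⟨mem_univ _, ht₁⟩⟩
    (hQc.prod (hρ.isCompact_piece (0 : RN N) (X + P) r))
    (prod_mono (piece_subset_cyl _ _ _) (piece_subset_cyl _ _ _)) fun Q hQ hle => by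
      obtain ⟨h1, h2, h3, h4, -, -⟩ := hbound Q hQ (hF₁.trans hle)
      have h5 := hnorm _ _ _ hC h1
      have h6 := hnorm _ _ _ hα h2
      refine ⟨⟨mem_closedBall_zero_iff.2 h6, hQ.1.2, (le_div_iff₀ hβ).2 (by linarith)⟩,
        ⟨mem_closedBall_zero_iff.2 ?_, hQ.2.2, (le_div_iff₀ hβ).2 (by linarith)⟩⟩
      calc ‖Q.2.1‖ = ‖Q.1.1 - (Q.1.1 - Q.2.1)‖ := by rw [sub_sub_cancel]
        _ ≤ ‖Q.1.1‖ + ‖Q.1.1 - Q.2.1‖ := norm_sub_le _ _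
        _ ≤ X + P := add_le_add h6 h5
  change t ∈ J at ht
  change s ∈ J at hs
  obtain ⟨hCp, hαx, hρt, hρs, hnts, hval⟩ := hbound ((x, t), (y, s)) ⟨⟨mem_univ _, ht⟩,
    ⟨mem_univ _, hs⟩⟩ (hF₁.trans hle)
  simp only at hCp hαx hρt hρs hnts hval
  replace hmax : ∀ p ∈ cyl N J, ∀ q ∈ cyl N J, u p - v q - doublingPenalty ρ C γ α β n p q ≤
      u (x, t) - v (y, s) - doublingPenalty ρ C γ α β n (x, t) (y, s) :=
    fun p hp q hq => hmax (show (p, q) ∈ cyl N J ×ˢ cyl N J from ⟨hp, hq⟩)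
  clear_value F
  have hts : |t - s| < δ₀ := by
    refine abs_lt_of_sq_lt_sq ?_ hδ₀0.le
    by_contra! hge
    have h1 : n * δ₀ ^ 2 = 2 * B + 1 := div_mul_cancel₀ _ (by positivity)
    have h2 : n * δ₀ ^ 2 ≤ n * (t - s) ^ 2 := by gcongr
    linarith only [h1, h2, hnts]
  have hts₁ : |t - s| < δ₁ := hts.trans_le ((min_le_left _ _).trans (min_le_left _ _))
  have hts₂ : |t - s| < δ₂ := hts.trans_le ((min_le_left _ _).trans (min_le_right _ _))
  have hts₃ : |t - s| < δ₃ := hts.trans_le ((min_le_right _ _).trans (min_le_left _ _))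
  have hts₄ : |t - s| < δ₄ := hts.trans_le ((min_le_right _ _).trans (min_le_right _ _))
  have htk : t ∈ k := ⟨ht, (le_div_iff₀ hβ).2 (by linarith)⟩
  have hsk : s ∈ k := ⟨hs, (le_div_iff₀ hβ).2 (by linarith)⟩
  have hinit : t ≤ δ₃ → s ≤ δ₄ → False := fun h3 h4 => by
    have h5 := hlu t ht h3 x
    have h6 := hlv s hs h4 y
    linarith only [hmod x y, h5, h6, hval, hg]
  have ht0 : 0 < t := by
    refine hρ.pos ht fun h => ?_
    rw [h, zero_sub, abs_neg, abs_of_nonneg (hρ.nonneg s hs)] at hts₄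
    exact hinit (h.trans_le hδ₃.le) hts₄.le
  have hs0 : 0 < s := by
    refine hρ.pos hs fun h => ?_
    rw [h, sub_zero, abs_of_nonneg (hρ.nonneg t ht)] at hts₃
    exact hinit hts₃.le (h.trans_le hδ₄.le)
  have hder := deriv_le_of_isMaxOn_doubling hρ hu hv hK hC.le hα.le hβ.le ht hs ht0 hs0 hmax
  set E := C * Real.exp (γ * t) with hE
  set D := ‖fderiv ℝ softNorm (x - y)‖ with hD
  have hD0 : 0 ≤ D := norm_nonneg _
  have hD1 : D ≤ 1 := norm_fderiv_softNorm_le_one _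
  have hE0 : 0 < E := by positivity
  have hEEm : E ≤ Em := by
    simp only [hE, hEm]
    gcongr
    exact hρ.le t ht
  have hEγ : 0 ≤ γ * E * softNorm (x - y) :=
    mul_nonneg (mul_nonneg hγ0 hE0.le) (softNorm_nonneg _)
  have hcp := abs_le.1 (hK x t ht _ (hu.1.measurableSet_slice ht (u (x, t))))
  have hcm := abs_le.1 (hK y s hs _ (hv.1.measurableSet_slice hs (v (y, s))))
  rw [← cPlus_eq] at hcp
  rw [← cMinus_eq] at hcm
  have hDd : d ≤ D := by
    -- Where the gradient is small, the bounded velocities cannot balance `β`.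
    by_contra! hDd
    have h1 : (cPlus c₀ c₁ u x t - cMinus c₀ c₁ v y s) * (E * D) ≤ 2 * K * (Em * d) := by
      have h2 : E * D ≤ Em * d := by gcongr
      have h3 : 0 ≤ E * D := by positivity
      calc _ ≤ 2 * K * (E * D) := by
            gcongr
            linarith [hcp.2, hcm.1]
        _ ≤ _ := by gcongr
    have h2 : 2 * K * (Em * d) = β / 4 := by
      rw [hd]
      field_simp
      norm_num
    linarith
  have hχ : d ^ 2 / 2 ≤ softNorm (x - y) := by
    have h1 := norm_fderiv_softNorm_sq_le (x - y)
    have h2 : d ^ 2 ≤ D ^ 2 := by gcongr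
    linarith
  have hpP : ‖x - y‖ ≤ P := hnorm _ _ _ hC hCp
  have hconv := setConv_le_of_translate_subset (f := c₀ t) (g := c₀ s) (hc₀ t ht)
    (hu.1.measurableSet_slice ht (u (x, t))) (hv.1.measurableSet_slice hs (v (y, s))) (x := x)
    (y := y) (p := (1 - θ) • (y - x)) (R := R') fun z hz hzR => by
      refine lt_of_isMaxOn_doubling hρ hC.le hγ0 hα.le ht hs hθ0.le hθ1 hmax hz ?_
      calc α * ‖z - x‖ ≤ α * R' := by gcongr
        _ < κ := hα3
        _ ≤ C * θ * softNorm (x - y) := by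
          rw [hκ]
          gcongr
  have hshift : x + (1 - θ) • (y - x) - y = θ • (x - y) := by
    rw [sub_smul, one_smul, ← neg_sub x y, smul_neg]
    abel
  have he₁ : ‖shift (x + (1 - θ) • (y - x) - y) (c₀ t) - c₀ t‖ ≤ e := by
    refine (hRδ t htk).2 _ ?_
    rw [hshift, norm_smul, Real.norm_of_nonneg hθ0.le]
    calc θ * ‖x - y‖ ≤ θ * P := by gcongr
      _ ≤ δ := hθP
  have he₂ := (hRδ t htk).1 x R' (le_max_left _ _) (hc₀ t ht)
  have he₃ : ‖c₀ t - c₀ s‖ ≤ e := by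
    have := (hc₀u t htk s hsk (by rwa [Real.dist_eq])).le
    rwa [dist_eq_norm] at this
  have he₄ : c₁ (x, t) - c₁ (x, s) ≤ e := by
    have hxX : x ∈ Metric.closedBall (0 : RN N) X :=
      mem_closedBall_zero_iff.2 (hnorm _ _ _ hα hαx)
    have := (hc₁u (x, t) ⟨hxX, htk⟩ (x, s) ⟨hxX, hsk⟩ (by
      rwa [dist_prod_same_left, Real.dist_eq])).le
    rw [Real.dist_eq] at this
    exact (abs_le.1 this).2
  have he₅ := (abs_le.1 (hLip x y s hs)).2
  have hdiff : cPlus c₀ c₁ u x t - cMinus c₀ c₁ v y s ≤ L * ‖x - y‖ + 4 * e := by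
    rw [cPlus_eq, cMinus_eq]
    linarith
  have h1 : (cPlus c₀ c₁ u x t - cMinus c₀ c₁ v y s) * (E * D) ≤
      (L * ‖x - y‖ + 4 * e) * (E * D) := by gcongr
  have h2 : L * ‖x - y‖ * (E * D) ≤ γ * E * softNorm (x - y) := by
    have := mul_le_mul_of_nonneg_left (norm_mul_norm_fderiv_softNorm_le (x - y))
      (mul_nonneg hL hE0.le)
    calc L * ‖x - y‖ * (E * D) = L * E * (‖x - y‖ * D) := by ring
      _ ≤ L * E * (2 * softNorm (x - y)) := this
      _ = γ * E * softNorm (x - y) := by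
        rw [hγ]
        ring
  have h3 : 4 * e * (E * D) ≤ β / 4 := by
    have h4 : E * D ≤ Em * 1 := by gcongr
    calc 4 * e * (E * D) ≤ 4 * e * (Em * 1) := by gcongr
      _ = β / 4 := by
        rw [he]
        field_simp
        norm_num
  linarith

end Comparison

/-! ### Semicontinuous envelopes -/

section Envelopes

variable {X : Type*} [TopologicalSpace X] {S : Set X} {u : X → ℝ} {p : X} {a : ℝ}

theorem uscEnvelope_le (hp : p ∈ S) (h : ∀ᶠ q in 𝓝[S] p, u q ≤ a) : uscEnvelope S u p ≤ a := by
  rw [uscEnvelope, limsup_eq]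
  exact csInf_le ⟨u p, fun b hb => hb.self_of_nhdsWithin hp⟩ h

theorem LocallyBoundedOn.eventually_lt (hu : LocallyBoundedOn u S) (hp : p ∈ S)
    (h : uscEnvelope S u p < a) : ∀ᶠ q in 𝓝[S] p, u q < a := by
  rw [uscEnvelope, limsup_eq] at h
  obtain ⟨C, hC⟩ := hu p hp
  obtain ⟨b, hb, hba⟩ := exists_lt_of_csInf_lt ⟨C, hC.mono fun q hq => (abs_le.1 hq).2⟩ h
  have hb' : ∀ᶠ q in 𝓝[S] p, u q ≤ b := hb
  exact hb'.mono fun q hq => hq.trans_lt hba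

theorem LocallyBoundedOn.le_uscEnvelope (hu : LocallyBoundedOn u S) (hp : p ∈ S) :
    u p ≤ uscEnvelope S u p :=
  le_of_forall_gt fun _ ha => (hu.eventually_lt hp ha).self_of_nhdsWithin hp

theorem LocallyBoundedOn.upperSemicontinuousOn_uscEnvelope (hu : LocallyBoundedOn u S) :
    UpperSemicontinuousOn (uscEnvelope S u) S := by
  intro p hp a ha
  obtain ⟨b, hb, hba⟩ := exists_between ha
  filter_upwards [eventually_eventually_nhdsWithin.2 (hu.eventually_lt hp hb),
    self_mem_nhdsWithin] with q hq hqS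
  exact (uscEnvelope_le hqS (hq.mono fun _ h => h.le)).trans_lt hba

theorem le_lscEnvelope (hp : p ∈ S) (h : ∀ᶠ q in 𝓝[S] p, a ≤ u q) : a ≤ lscEnvelope S u p := by
  rw [lscEnvelope, liminf_eq]
  exact le_csSup ⟨u p, fun b hb => hb.self_of_nhdsWithin hp⟩ h

theorem LocallyBoundedOn.eventually_gt (hu : LocallyBoundedOn u S) (hp : p ∈ S)
    (h : a < lscEnvelope S u p) : ∀ᶠ q in 𝓝[S] p, a < u q := by
  rw [lscEnvelope, liminf_eq] at h
  obtain ⟨C, hC⟩ := hu p hp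
  obtain ⟨b, hb, hba⟩ := exists_lt_of_lt_csSup ⟨-C, hC.mono fun q hq => (abs_le.1 hq).1⟩ h
  have hb' : ∀ᶠ q in 𝓝[S] p, b ≤ u q := hb
  exact hb'.mono fun q hq => hba.trans_le hq

theorem LocallyBoundedOn.lscEnvelope_le (hu : LocallyBoundedOn u S) (hp : p ∈ S) :
    lscEnvelope S u p ≤ u p :=
  le_of_forall_lt fun _ ha => (hu.eventually_gt hp ha).self_of_nhdsWithin hp

theorem LocallyBoundedOn.lowerSemicontinuousOn_lscEnvelope (hu : LocallyBoundedOn u S) :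
    LowerSemicontinuousOn (lscEnvelope S u) S := by
  intro p hp a ha
  obtain ⟨b, hab, hb⟩ := exists_between ha
  filter_upwards [eventually_eventually_nhdsWithin.2 (hu.eventually_gt hp hb),
    self_mem_nhdsWithin] with q hq hqS
  exact hab.trans_le (le_lscEnvelope hqS (hq.mono fun _ h => h.le))

theorem uscEnvelope_le_of_continuousOn {φ : X → ℝ} (hφ : ContinuousOn φ S) (h : ∀ q ∈ S, u q ≤ φ q)
    (hp : p ∈ S) : uscEnvelope S u p ≤ φ p := by
  refine le_of_forall_gt_imp_ge_of_dense fun a ha => uscEnvelope_le hp ?_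
  filter_upwards [(hφ p hp).eventually (gt_mem_nhds ha), self_mem_nhdsWithin] with q hq hqS
  exact (h q hqS).trans hq.le

theorem le_lscEnvelope_of_continuousOn {φ : X → ℝ} (hφ : ContinuousOn φ S) (h : ∀ q ∈ S, φ q ≤ u q)
    (hp : p ∈ S) : φ p ≤ lscEnvelope S u p := by
  refine le_of_forall_lt_imp_le_of_dense fun a ha => le_lscEnvelope hp ?_
  filter_upwards [(hφ p hp).eventually (lt_mem_nhds ha), self_mem_nhdsWithin] with q hq hqS
  exact hq.le.trans (h q hqS)

theorem LocallyBoundedOn.of_forall_abs_le {C : ℝ} (h : ∀ q ∈ S, |u q| ≤ C) :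
    LocallyBoundedOn u S :=
  fun _ _ => ⟨C, eventually_nhdsWithin_of_forall h⟩

end Envelopes

/-! ### Calculus of test functions -/

section TestFunctions

variable {N : ℕ} {J : Set ℝ} {T : ℝ} {ρ : ℝ → ℝ} {φ ψ : RN N × ℝ → ℝ}

/-- The time derivative of a test function, one-sided at the end points of `J`. -/
noncomputable def timeDeriv (J : Set ℝ) (φ : RN N × ℝ → ℝ) (p : RN N × ℝ) : ℝ :=
  fderivWithin ℝ φ (cyl N J) p (0, 1)

/-- The space derivative of a test function. -/
noncomputable def spaceDeriv (J : Set ℝ) (φ : RN N × ℝ → ℝ) (p : RN N × ℝ) : RN N →L[ℝ] ℝ :=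
  (fderivWithin ℝ φ (cyl N J) p).comp (ContinuousLinearMap.inl ℝ (RN N) ℝ)

theorem hasDerivWithinAt_timeDeriv (hφ : ContDiffOn ℝ 1 φ (cyl N J)) {x : RN N} {t : ℝ}
    (ht : t ∈ J) : HasDerivWithinAt (fun s => φ (x, s)) (timeDeriv J φ (x, t)) J t := by
  have h1 := (hφ.differentiableOn one_ne_zero (x, t) ⟨mem_univ _, ht⟩).hasFDerivWithinAt
  have h2 : HasDerivWithinAt (fun s : ℝ => (x, s)) ((0 : RN N), (1 : ℝ)) J t :=
    (hasDerivWithinAt_const t J x).prodMk (hasDerivWithinAt_id t J)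
  exact h1.comp_hasDerivWithinAt t h2 fun s hs => ⟨mem_univ _, hs⟩

theorem hasFDerivAt_spaceDeriv (hφ : ContDiffOn ℝ 1 φ (cyl N J)) {x : RN N} {t : ℝ}
    (ht : t ∈ J) : HasFDerivAt (fun y => φ (y, t)) (spaceDeriv J φ (x, t)) x := by
  have h1 := (hφ.differentiableOn one_ne_zero (x, t) ⟨mem_univ _, ht⟩).hasFDerivWithinAt
  have h2 : HasFDerivWithinAt (fun y : RN N => (y, t)) (ContinuousLinearMap.inl ℝ (RN N) ℝ) univ
      x := (hasFDerivAt_prodMk_left x t).hasFDerivWithinAt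
  have h3 : MapsTo (fun y : RN N => (y, t)) univ (cyl N J) := fun y _ => ⟨mem_univ _, ht⟩
  exact hasFDerivWithinAt_univ.1 (h1.comp x h2 h3)

theorem continuousOn_timeDeriv (hρ : IsTimeExhaustion J T ρ) (hφ : ContDiffOn ℝ 1 φ (cyl N J)) :
    ContinuousOn (timeDeriv J φ) (cyl N J) :=
  (hφ.continuousOn_fderivWithin (hρ.uniqueDiffOn_cyl N) le_rfl).clm_apply continuousOn_const

theorem continuousOn_spaceDeriv (hρ : IsTimeExhaustion J T ρ) (hφ : ContDiffOn ℝ 1 φ (cyl N J)) :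
    ContinuousOn (spaceDeriv J φ) (cyl N J) :=
  (hφ.continuousOn_fderivWithin (hρ.uniqueDiffOn_cyl N) le_rfl).clm_comp continuousOn_const

theorem timeDeriv_eq (hρ : IsTimeExhaustion J T ρ) (hφ : ContDiffOn ℝ 1 φ (cyl N J)) {x : RN N}
    {t a : ℝ} (ht : t ∈ J) (h : HasDerivWithinAt (fun s => φ (x, s)) a J t) :
    timeDeriv J φ (x, t) = a :=
  (hρ.uniqueDiffOn t ht).eq_deriv _ (hasDerivWithinAt_timeDeriv hφ ht) h

theorem spaceDeriv_eq (hφ : ContDiffOn ℝ 1 φ (cyl N J)) {x : RN N} {t : ℝ} {L : RN N →L[ℝ] ℝ}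
    (ht : t ∈ J) (h : HasFDerivAt (fun y => φ (y, t)) L x) : spaceDeriv J φ (x, t) = L :=
  (hasFDerivAt_spaceDeriv hφ ht).unique h

/-- At a positive time, possibly the last one, the time derivative is nonnegative at a maximum. -/
theorem HasDerivWithinAt.nonneg_of_isMaxOn (hρ : IsTimeExhaustion J T ρ) {f : ℝ → ℝ} {a t : ℝ}
    (ht : t ∈ J) (hf : HasDerivWithinAt f a J t) (hmax : IsMaxOn f J t) (h0 : 0 < t) : 0 ≤ a := by
  have hcone : (0 : ℝ) - t ∈ posTangentConeAt J t :=
    sub_mem_posTangentConeAt_of_segment_subset (hρ.convex.segment_subset ht hρ.zero_mem)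
  have h := hmax.localize.hasFDerivWithinAt_nonpos hf.hasFDerivWithinAt hcone
  rw [zero_sub] at h
  have h2 : -t * a ≤ 0 := by simpa using h
  nlinarith

/-- First-order conditions at a positive time where a smooth function is touched from above by a
test function. -/
theorem derivWithin_le_of_isMaxOn_sub (hρ : IsTimeExhaustion J T ρ)
    (hψ : ContDiffOn ℝ 1 ψ (cyl N J)) (hφ : ContDiffOn ℝ 1 φ (cyl N J)) {x : RN N} {t : ℝ}
    (ht : t ∈ J) (h0 : 0 < t) (hmax : IsMaxOn (fun p => ψ p - φ p) (cyl N J) (x, t)) :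
    derivWithin (fun s => φ (x, s)) J t ≤ timeDeriv J ψ (x, t) ∧
      ‖gradient (fun y => φ (y, t)) x‖ = ‖spaceDeriv J ψ (x, t)‖ := by
  have h1 := hasDerivWithinAt_timeDeriv hφ (x := x) ht
  have h2 := hasFDerivAt_spaceDeriv hφ (x := x) ht
  rw [h1.derivWithin (hρ.uniqueDiffOn t ht), norm_gradient_of_hasFDerivAt h2]
  constructor
  · have h3 := (hasDerivWithinAt_timeDeriv hψ (x := x) ht).sub h1
    have h4 := h3.nonneg_of_isMaxOn hρ ht
      (fun s hs => hmax (show ((x, s) : RN N × ℝ) ∈ cyl N J from ⟨mem_univ _, hs⟩)) h0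
    linarith
  · have h3 := (hasFDerivAt_spaceDeriv hψ (x := x) ht).sub h2
    have h4 : IsLocalMax ((fun y => ψ (y, t)) - fun y => φ (y, t)) x :=
      Eventually.of_forall fun y =>
        hmax (show ((y, t) : RN N × ℝ) ∈ cyl N J from ⟨mem_univ _, ht⟩)
    rw [sub_eq_zero.1 (h4.hasFDerivAt_eq_zero h3)]

/-- A `C¹` function on the cylinder which vanishes to second order at `p₀` and is coercive. -/
noncomputable def pointPenalty (ρ : ℝ → ℝ) (p₀ p : RN N × ℝ) : ℝ :=
  ‖p.1 - p₀.1‖ ^ 2 + (p.2 - p₀.2) ^ 2 + (ρ p.2 - ρ p₀.2) ^ 2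

theorem pointPenalty_nonneg (p₀ p : RN N × ℝ) : 0 ≤ pointPenalty ρ p₀ p := by
  unfold pointPenalty
  positivity

@[simp] theorem pointPenalty_self (p₀ : RN N × ℝ) : pointPenalty ρ p₀ p₀ = 0 := by
  simp [pointPenalty]

theorem contDiffOn_pointPenalty (hρ : IsTimeExhaustion J T ρ) (p₀ : RN N × ℝ) :
    ContDiffOn ℝ 1 (pointPenalty ρ p₀) (cyl N J) := by
  have h1 : ContDiff ℝ 1 fun p : RN N × ℝ => ‖p.1 - p₀.1‖ ^ 2 :=
    (contDiff_fst.sub contDiff_const).norm_sq ℝ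
  have h2 : ContDiff ℝ 1 fun p : RN N × ℝ => (p.2 - p₀.2) ^ 2 := by fun_prop
  exact (h1.add h2).contDiffOn.add (((hρ.contDiffOn_snd N).sub contDiffOn_const).pow 2)

theorem hasDerivWithinAt_pointPenalty (hρ : IsTimeExhaustion J T ρ) (x : RN N) {t : ℝ}
    (ht : t ∈ J) : HasDerivWithinAt (fun s => pointPenalty ρ (x, t) (x, s)) 0 J t := by
  have h1 := (((hasDerivWithinAt_id t J).sub_const t).pow 2).const_add (‖x - x‖ ^ 2)
  have h2 := (((hρ.hasDerivWithinAt ht).sub_const (ρ t)).pow 2)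
  exact (h1.add h2).congr_deriv (by simp)

theorem hasFDerivAt_pointPenalty (x : RN N) (t : ℝ) :
    HasFDerivAt (fun y => pointPenalty ρ (x, t) (y, t)) (0 : RN N →L[ℝ] ℝ) x := by
  have h1 : HasFDerivAt (fun y : RN N => ‖y - x‖ ^ 2) (0 : RN N →L[ℝ] ℝ) x := by
    have h := HasFDerivAt.comp (f := fun y : RN N => y - x) x
      (hasStrictFDerivAt_norm_sq (x - x)).hasFDerivAt ((hasFDerivAt_id x).sub_const x)
    rw [sub_self, map_zero, smul_zero, ContinuousLinearMap.zero_comp] at h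
    exact h
  exact (h1.add_const ((t - t) ^ 2)).add_const ((ρ t - ρ t) ^ 2)

theorem mem_piece_of_pointPenalty_le {p₀ p : RN N × ℝ} {e : ℝ} (hp : p ∈ cyl N J)
    (h : pointPenalty ρ p₀ p ≤ e) :
    p ∈ Metric.closedBall p₀.1 (e + 1) ×ˢ {t ∈ J | ρ t ≤ ρ p₀.2 + (e + 1)} := by
  unfold pointPenalty at h
  have h1 := sq_nonneg ‖p.1 - p₀.1‖
  have h2 := sq_nonneg (p.2 - p₀.2)
  have h3 := sq_nonneg (ρ p.2 - ρ p₀.2)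
  refine ⟨mem_closedBall_iff_norm.2 ?_, hp.2, ?_⟩
  · nlinarith [sq_nonneg (‖p.1 - p₀.1‖ - 1)]
  · nlinarith [sq_nonneg (ρ p.2 - ρ p₀.2 - 1)]

theorem tendsto_of_pointPenalty {p₀ : RN N × ℝ} {P : ℕ → RN N × ℝ}
    (h : Tendsto (fun n => pointPenalty ρ p₀ (P n)) atTop (𝓝 0)) : Tendsto P atTop (𝓝 p₀) := by
  have h1 : Tendsto (fun n => √(pointPenalty ρ p₀ (P n))) atTop (𝓝 0) := by
    have := (Real.continuous_sqrt.tendsto 0).comp h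
    rw [Real.sqrt_zero] at this
    exact this
  refine tendsto_iff_dist_tendsto_zero.2 (squeeze_zero (fun n => dist_nonneg) (fun n => ?_) h1)
  rw [Prod.dist_eq, dist_eq_norm, Real.dist_eq]
  refine max_le (Real.le_sqrt_of_sq_le ?_) (Real.le_sqrt_of_sq_le ?_)
  · unfold pointPenalty
    nlinarith [sq_nonneg ((P n).2 - p₀.2), sq_nonneg (ρ (P n).2 - ρ p₀.2)]
  · unfold pointPenalty
    rw [sq_abs]
    nlinarith [sq_nonneg ‖(P n).1 - p₀.1‖, sq_nonneg (ρ (P n).2 - ρ p₀.2)]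

end TestFunctions

/-! ### Stability and Perron's method -/

section Perron

variable {N : ℕ} {J : Set ℝ} {T K : ℝ} {ρ : ℝ → ℝ} {c₀ : ℝ → Lp ℝ 1 (volume : Measure (RN N))}
  {c₁ : RN N × ℝ → ℝ} {u₀ : RN N → ℝ}

theorem cPlus_mono {u w : RN N × ℝ → ℝ} {x : RN N} {t : ℝ} (hc₀ : 0 ≤ c₀ t) (ht : t ∈ J)
    (hu : UpperSemicontinuousOn u (cyl N J)) (hw : UpperSemicontinuousOn w (cyl N J))
    (h : ∀ y, u (y, t) ≤ w (y, t)) (hx : u (x, t) = w (x, t)) :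
    cPlus c₀ c₁ u x t ≤ cPlus c₀ c₁ w x t := by
  rw [cPlus_eq, cPlus_eq, ← hx]
  gcongr
  exact setConv_mono hc₀ (hu.measurableSet_slice ht _) (hw.measurableSet_slice ht _)
    (fun y hy => le_trans hy (h y)) x

/-- Stability of the viscosity inequality under half-relaxed limits of subsolutions that lie below
an upper semicontinuous function. -/
theorem timeDeriv_le_of_tendsto (hρ : IsTimeExhaustion J T ρ) (hc₀ : ∀ t ∈ J, 0 ≤ c₀ t)
    (hc : VelocityRegularity J c₀ c₁) {w : ℕ → RN N × ℝ → ℝ} {W : RN N × ℝ → ℝ}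
    (hw : ∀ n, IsSlepcevSubsolution J c₀ c₁ u₀ (w n)) (hW : UpperSemicontinuousOn W (cyl N J))
    (hwW : ∀ n, ∀ p ∈ cyl N J, w n p ≤ W p) {P : ℕ → RN N × ℝ} (hP : ∀ n, P n ∈ cyl N J) {x : RN N}
    {t : ℝ} (ht : t ∈ J) (h0 : 0 < t) (hPx : Tendsto P atTop (𝓝 (x, t)))
    (hwP : Tendsto (fun n => w n (P n)) atTop (𝓝 (W (x, t)))) {φ : RN N × ℝ → ℝ}
    (hφ : ContDiffOn ℝ 1 φ (cyl N J))
    (hmax : IsMaxOn (fun p => W p - φ p) (cyl N J) (x, t)) :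
    timeDeriv J φ (x, t) ≤ cPlus c₀ c₁ W x t * ‖spaceDeriv J φ (x, t)‖ := by
  have hx : ((x, t) : RN N × ℝ) ∈ cyl N J := ⟨mem_univ _, ht⟩
  set q := pointPenalty ρ ((x, t) : RN N × ℝ) with hq
  set φ' : RN N × ℝ → ℝ := fun p => φ p + q p with hφ'
  have hqd : ContDiffOn ℝ 1 q (cyl N J) := contDiffOn_pointPenalty hρ _
  have hφ'd : ContDiffOn ℝ 1 φ' (cyl N J) := hφ.add hqd
  have hq0 : q (x, t) = 0 := pointPenalty_self _
  set ε : ℕ → ℝ := fun n => W (x, t) - φ (x, t) - (w n (P n) - φ' (P n)) with hε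
  have hPw : Tendsto P atTop (𝓝[cyl N J] (x, t)) :=
    tendsto_nhdsWithin_iff.2 ⟨hPx, Eventually.of_forall hP⟩
  have hε0 : Tendsto ε atTop (𝓝 0) := by
    have h1 := (hφ'd.continuousOn (x, t) hx).tendsto.comp hPw
    have h2 := (hwP.sub h1).const_sub (W (x, t) - φ (x, t))
    have h3 : W (x, t) - φ (x, t) - (W (x, t) - φ' (x, t)) = 0 := by
      simp only [hφ', hq0]
      ring
    rw [h3] at h2
    exact h2
  have hbound : ∀ n, ∀ p ∈ cyl N J, w n (P n) - φ' (P n) ≤ w n p - φ' p → q p ≤ ε n :=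
    fun n p hp h => by
      have h1 : W p - φ p ≤ W (x, t) - φ (x, t) := hmax hp
      have h2 := hwW n p hp
      simp only [hε, hφ'] at h ⊢
      linarith
  have hex : ∀ n, ∃ p ∈ cyl N J, IsMaxOn (fun p => w n p - φ' p) (cyl N J) p ∧
      w n (P n) - φ' (P n) ≤ w n p - φ' p := fun n =>
    exists_isMaxOn_of_superlevel_subset ((hw n).1.sub_continuousOn hφ'd.continuousOn) (hP n)
      (hρ.isCompact_piece _ _ _) (piece_subset_cyl _ _ _) fun p hp h =>
        mem_piece_of_pointPenalty_le hp (hbound n p hp h)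
  choose Q hQ hQmax hQle using hex
  have hQx : Tendsto Q atTop (𝓝 (x, t)) := tendsto_of_pointPenalty (ρ := ρ)
    (squeeze_zero (fun n => pointPenalty_nonneg _ _) (fun n => hbound n _ (hQ n) (hQle n)) hε0)
  have hQw : Tendsto Q atTop (𝓝[cyl N J] (x, t)) :=
    tendsto_nhdsWithin_iff.2 ⟨hQx, Eventually.of_forall hQ⟩
  have hQ1 : Tendsto (fun n => (Q n).1) atTop (𝓝 x) := (continuous_fst.tendsto _).comp hQx
  have hQ2 : Tendsto (fun n => (Q n).2) atTop (𝓝 t) := (continuous_snd.tendsto _).comp hQx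
  have hQJ : Tendsto (fun n => (Q n).2) atTop (𝓝[J] t) :=
    tendsto_nhdsWithin_iff.2 ⟨hQ2, Eventually.of_forall fun n => (hQ n).2⟩
  have hlow : ∀ a < W (x, t), ∀ᶠ n in atTop, a < w n (Q n) := fun a ha => by
    have h1 := (hφ'd.continuousOn (x, t) hx).tendsto.comp hPw
    have h2 := (hφ'd.continuousOn (x, t) hx).tendsto.comp hQw
    have h3 := (hwP.sub h1).add h2
    rw [sub_add_cancel] at h3
    filter_upwards [h3.eventually (lt_mem_nhds ha)] with n hn
    have h4 := hQle n
    simp only [Function.comp_apply] at hn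
    linarith
  have hvel : ∀ c, cPlus c₀ c₁ W x t < c →
      ∀ᶠ n in atTop, cPlus c₀ c₁ (w n) (Q n).1 (Q n).2 < c := fun c hcc => by
    rw [cPlus_eq] at hcc
    obtain ⟨b, hb1, hb2⟩ := exists_between (lt_sub_iff_add_lt'.2 hcc)
    have h1 := eventually_setConv_lt (l := atTop) (F := fun n => c₀ (Q n).2)
      (A := fun n => {y | w n (Q n) ≤ w n (y, (Q n).2)}) (X := fun n => (Q n).1)
      (fun n => (hw n).1.measurableSet_slice (hQ n).2 _)
      (hW.measurableSet_slice ht (W (x, t))) (fun n => hc₀ _ (hQ n).2)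
      ((hc.kernel_continuous t ht).tendsto.comp hQJ) hQ1 (fun z hz => by
        obtain ⟨a, ha1, ha2⟩ := exists_between (not_le.1 (show ¬ W (x, t) ≤ W (z, t) from hz))
        have h2 : Tendsto (fun n => (z, (Q n).2)) atTop (𝓝[cyl N J] (z, t)) :=
          tendsto_nhdsWithin_iff.2 ⟨tendsto_const_nhds.prodMk_nhds hQ2,
            Eventually.of_forall fun n => ⟨mem_univ _, (hQ n).2⟩⟩
        filter_upwards [h2.eventually (hW (z, t) ⟨mem_univ _, ht⟩ a ha1), hlow a ha2] with n h3 h4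
        have h5 := hwW n (z, (Q n).2) ⟨mem_univ _, (hQ n).2⟩
        exact not_le.2 (h5.trans_lt (h3.trans h4))) hb1
    have h2 := (hc.force_continuous (x, t) hx).tendsto.comp hQw
    filter_upwards [h1, h2.eventually (gt_mem_nhds (lt_sub_comm.1 hb2))] with n h3 h4
    rw [cPlus_eq]
    simp only [Function.comp_apply] at h4
    linarith
  have htd : timeDeriv J φ' (x, t) = timeDeriv J φ (x, t) := by
    refine timeDeriv_eq hρ hφ'd ht ?_
    have := (hasDerivWithinAt_timeDeriv hφ (x := x) ht).add (hasDerivWithinAt_pointPenalty hρ x ht)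
    rwa [add_zero] at this
  have hsd : spaceDeriv J φ' (x, t) = spaceDeriv J φ (x, t) := by
    refine spaceDeriv_eq hφ'd ht ?_
    have := (hasFDerivAt_spaceDeriv hφ (x := x) ht).add (hasFDerivAt_pointPenalty (ρ := ρ) x t)
    rwa [add_zero] at this
  rw [← htd, ← hsd]
  have hlim1 := (continuousOn_timeDeriv hρ hφ'd (x, t) hx).tendsto.comp hQw
  have hlim2 := (continuousOn_spaceDeriv hρ hφ'd (x, t) hx).tendsto.comp hQw
  have hkey : ∀ c, cPlus c₀ c₁ W x t < c →
      timeDeriv J φ' (x, t) ≤ c * ‖spaceDeriv J φ' (x, t)‖ := fun c hcc => by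
    refine le_of_tendsto_of_tendsto hlim1 (hlim2.norm.const_mul c) ?_
    filter_upwards [hvel c hcc, hQ2.eventually (lt_mem_nhds h0)] with n h1 h2
    have h3 := (hw n).deriv_le hρ hφ'd (hQ n).2 (hQmax n) h2
      (hasDerivWithinAt_timeDeriv hφ'd (hQ n).2) (hasFDerivAt_spaceDeriv hφ'd (hQ n).2)
    exact h3.trans (mul_le_mul_of_nonneg_right h1.le (norm_nonneg _))
  have hlimc : Tendsto (fun c => c * ‖spaceDeriv J φ' (x, t)‖) (𝓝[>] (cPlus c₀ c₁ W x t))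
      (𝓝 (cPlus c₀ c₁ W x t * ‖spaceDeriv J φ' (x, t)‖)) :=
    ((continuous_mul_const _).tendsto _).mono_left nhdsWithin_le_nhds
  exact ge_of_tendsto hlimc (eventually_nhdsWithin_of_forall hkey)

/-- Lower barriers that spread at the maximal speed are subsolutions. -/
theorem isSlepcevSubsolution_barrier (hρ : IsTimeExhaustion J T ρ) (hK : IsSpeedBound J c₀ c₁ K)
    {b C : ℝ} (hC : 0 ≤ C) {x₀ : RN N} (hu₀ : ∀ x, b - C * softNorm (x - x₀) ≤ u₀ x) :
    IsSlepcevSubsolution J c₀ c₁ u₀ fun p => b - C * (softNorm (p.1 - x₀) + K * p.2) := by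
  set w : RN N × ℝ → ℝ := fun p => b - C * (softNorm (p.1 - x₀) + K * p.2) with hw
  have hwd : ContDiffOn ℝ 1 w (cyl N J) := by
    have h1 : ContDiff ℝ 1 fun p : RN N × ℝ => softNorm (p.1 - x₀) :=
      contDiff_softNorm.comp (contDiff_fst.sub contDiff_const)
    exact (contDiff_const.sub (contDiff_const.mul
      (h1.add (contDiff_const.mul contDiff_snd)))).contDiffOn
  have hwu := hwd.continuousOn.upperSemicontinuousOn
  refine ⟨hwu, fun φ hφ x t ht hmax => ⟨fun h0 => ?_, fun h0 => ?_⟩⟩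
  · obtain ⟨h1, h2⟩ := derivWithin_le_of_isMaxOn_sub hρ hwd hφ ht h0 hmax
    have h3 : timeDeriv J w (x, t) = -(C * K) := by
      refine timeDeriv_eq hρ hwd ht ?_
      exact (((((hasDerivWithinAt_id t J).const_mul K).const_add
        (softNorm (x - x₀))).const_mul C).const_sub b).congr_deriv (by simp)
    have h4 : spaceDeriv J w (x, t) = -(C • fderiv ℝ softNorm (x - x₀)) :=
      spaceDeriv_eq hwd ht ((((hasFDerivAt_softNorm_sub x₀ x).add_const (K * t)).const_mul
        C).const_sub b)
    have h5 := abs_le.1 (hK x t ht _ (hwu.measurableSet_slice ht (w (x, t))))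
    rw [← cPlus_eq] at h5
    have h6 : ‖spaceDeriv J w (x, t)‖ ≤ C := by
      rw [h4, norm_neg, norm_smul, Real.norm_of_nonneg hC]
      exact mul_le_of_le_one_right hC (norm_fderiv_softNorm_le_one _)
    rw [h2]
    have h7 := mul_le_mul_of_nonneg_right h5.1 (norm_nonneg (spaceDeriv J w (x, t)))
    have h8 : K * ‖spaceDeriv J w (x, t)‖ ≤ K * C :=
      mul_le_mul_of_nonneg_left h6 (by linarith [h5.1, h5.2])
    linarith
  · simpa [hw] using hu₀ x

/-- The upper semicontinuous envelope of the supremum of all subsolutions is the largest one. -/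
theorem exists_greatest_subsolution (hρ : IsTimeExhaustion J T ρ) (hc₀ : ∀ t ∈ J, 0 ≤ c₀ t)
    (hc : VelocityRegularity J c₀ c₁) (hu₀ : UniformContinuous u₀)
    (hb : ∃ B : ℝ, ∀ x, |u₀ x| ≤ B) :
    ∃ W : RN N × ℝ → ℝ, IsSlepcevSubsolution J c₀ c₁ u₀ W ∧
      ∀ w, IsSlepcevSubsolution J c₀ c₁ u₀ w → ∀ p ∈ cyl N J, w p ≤ W p := by
  obtain ⟨K, hK0, hK⟩ := hc.exists_isSpeedBound
  obtain ⟨B, hB⟩ := hb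
  set S : RN N × ℝ → ℝ := fun p => sSup ((fun w => w p) '' {w | IsSlepcevSubsolution J c₀ c₁ u₀ w})
    with hS
  have hconst : IsSlepcevSubsolution J c₀ c₁ u₀ fun p => -B - 0 * (softNorm (p.1 - 0) + K * p.2) :=
    isSlepcevSubsolution_barrier hρ hK le_rfl fun x => by linarith [(abs_le.1 (hB x)).1]
  have hwB : ∀ w, IsSlepcevSubsolution J c₀ c₁ u₀ w → ∀ p ∈ cyl N J, w p ≤ B := fun w hw p hp =>
    (hw.isEikonalSubsolution hK).le_of_initial_le hρ hK0.le (fun x => (abs_le.1 (hB x)).2) hp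
  have hbdd : ∀ p ∈ cyl N J,
      BddAbove ((fun w => w p) '' {w | IsSlepcevSubsolution J c₀ c₁ u₀ w}) := by
    rintro p hp
    refine ⟨B, ?_⟩
    rintro _ ⟨w, hw, rfl⟩
    exact hwB w hw p hp
  have hne : ∀ p, ((fun w => w p) '' {w | IsSlepcevSubsolution J c₀ c₁ u₀ w}).Nonempty :=
    fun p => ⟨_, _, hconst, rfl⟩
  have hwS : ∀ w, IsSlepcevSubsolution J c₀ c₁ u₀ w → ∀ p ∈ cyl N J, w p ≤ S p :=
    fun w hw p hp => le_csSup (hbdd p hp) ⟨w, hw, rfl⟩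
  have hSle : ∀ p ∈ cyl N J, ∀ a, (∀ w, IsSlepcevSubsolution J c₀ c₁ u₀ w → w p ≤ a) → S p ≤ a :=
    fun p hp a h => csSup_le (hne p) (by
      rintro _ ⟨w, hw, rfl⟩
      exact h w hw)
  have hlb : LocallyBoundedOn S (cyl N J) := .of_forall_abs_le (C := B) fun p hp => by
    refine abs_le.2 ⟨?_, hSle p hp B fun w hw => hwB w hw p hp⟩
    simpa using hwS _ hconst p hp
  set W := uscEnvelope (cyl N J) S with hW
  have hSW : ∀ p ∈ cyl N J, S p ≤ W p := fun p hp => hlb.le_uscEnvelope hp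
  have hWusc : UpperSemicontinuousOn W (cyl N J) := hlb.upperSemicontinuousOn_uscEnvelope
  refine ⟨W, ⟨hWusc, fun φ hφ x t ht hmax => ⟨fun h0 => ?_, fun h0 => ?_⟩⟩,
    fun w hw p hp => (hwS w hw p hp).trans (hSW p hp)⟩
  · rw [(hasDerivWithinAt_timeDeriv hφ ht).derivWithin (hρ.uniqueDiffOn t ht),
      norm_gradient_of_hasFDerivAt (hasFDerivAt_spaceDeriv hφ ht)]
    have hx : ((x, t) : RN N × ℝ) ∈ cyl N J := ⟨mem_univ _, ht⟩
    have hex : ∀ n : ℕ, ∃ w, IsSlepcevSubsolution J c₀ c₁ u₀ w ∧ ∃ p ∈ cyl N J,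
        dist p (x, t) < 1 / ((n : ℝ) + 1) ∧ W (x, t) - 1 / ((n : ℝ) + 1) < w p ∧
        W p < W (x, t) + 1 / ((n : ℝ) + 1) := by
      intro n
      have hn : 0 < 1 / ((n : ℝ) + 1) := by positivity
      have h1 : ∃ᶠ p in 𝓝[cyl N J] (x, t), W (x, t) - 1 / ((n : ℝ) + 1) < S p := by
        intro h
        have := uscEnvelope_le hx (h.mono fun p hp => not_lt.1 hp)
        rw [← hW] at this
        linarith
      obtain ⟨p, h2, h3, h4, h5⟩ := (h1.and_eventually
        ((eventually_nhdsWithin_of_eventually_nhds (Metric.ball_mem_nhds _ hn)).and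
          ((hWusc (x, t) hx _ (lt_add_of_pos_right _ hn)).and self_mem_nhdsWithin))).exists
      obtain ⟨_, ⟨w, hw, rfl⟩, h6⟩ := exists_lt_of_lt_csSup (hne p) h2
      exact ⟨w, hw, p, h5, h3, h6, h4⟩
    choose w hw P hP hPd hPl hPu using hex
    have hn := tendsto_one_div_add_atTop_nhds_zero_nat (𝕜 := ℝ)
    refine timeDeriv_le_of_tendsto hρ hc₀ hc hw hWusc
      (fun n p hp => (hwS _ (hw n) p hp).trans (hSW p hp)) hP ht h0 ?_ ?_ hφ hmax
    · exact tendsto_iff_dist_tendsto_zero.2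
        (squeeze_zero (fun n => dist_nonneg) (fun n => (hPd n).le) hn)
    · have hn1 := hn.const_sub (W (x, t))
      have hn2 := hn.const_add (W (x, t))
      rw [sub_zero] at hn1
      rw [add_zero] at hn2
      refine tendsto_of_tendsto_of_tendsto_of_le_of_le hn1 hn2 (fun n => (hPl n).le) fun n => ?_
      exact ((hwS _ (hw n) _ (hP n)).trans (hSW _ (hP n))).trans (hPu n).le
  · subst h0
    refine le_of_forall_pos_le_add fun m hm => ?_
    obtain ⟨C, hC, hmod⟩ := hu₀.exists_softNorm_modulus ⟨B, hB⟩ hm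
    have hcont : Continuous fun p : RN N × ℝ => u₀ x + m + C * (softNorm (p.1 - x) + K * p.2) := by
      have := continuous_softNorm (N := N)
      fun_prop
    have := uscEnvelope_le_of_continuousOn hcont.continuousOn (S := cyl N J) (u := S)
      (p := ((x, 0) : RN N × ℝ)) (fun p hp => hSle p hp _ fun w hw =>
        (hw.isEikonalSubsolution hK).le_barrier hρ hK0.le hC
          (fun y => by linarith [hmod y x]) hp.2) ⟨mem_univ _, ht⟩
    simpa using this

/-- The bump construction: if the lower envelope of a subsolution `W` violates the viscosity
inequality of supersolutions, then the maximum of `W` and of a small smooth bump is a larger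
subsolution. -/
theorem isSlepcevSupersolution_of_greatest (hρ : IsTimeExhaustion J T ρ)
    (hc₀ : ∀ t ∈ J, 0 ≤ c₀ t) (hc : VelocityRegularity J c₀ c₁) (hu₀ : UniformContinuous u₀)
    (hb : ∃ B : ℝ, ∀ x, |u₀ x| ≤ B) {W : RN N × ℝ → ℝ} (hlb : LocallyBoundedOn W (cyl N J))
    (hW : IsSlepcevSubsolution J c₀ c₁ u₀ W)
    (hgr : ∀ w, IsSlepcevSubsolution J c₀ c₁ u₀ w → ∀ p ∈ cyl N J, w p ≤ W p) :
    IsSlepcevSupersolution J c₀ c₁ u₀ (lscEnvelope (cyl N J) W) := by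
  obtain ⟨K, hK0, hK⟩ := hc.exists_isSpeedBound
  set V := lscEnvelope (cyl N J) W with hV
  have hVlsc : LowerSemicontinuousOn V (cyl N J) := hlb.lowerSemicontinuousOn_lscEnvelope
  have hVW : ∀ p ∈ cyl N J, V p ≤ W p := fun p hp => hlb.lscEnvelope_le hp
  refine ⟨hVlsc, fun φ hφ x t ht hmin => ⟨fun h0 => ?_, fun h0 => ?_⟩⟩
  · have hx : ((x, t) : RN N × ℝ) ∈ cyl N J := ⟨mem_univ _, ht⟩
    rw [(hasDerivWithinAt_timeDeriv hφ ht).derivWithin (hρ.uniqueDiffOn t ht),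
      norm_gradient_of_hasFDerivAt (hasFDerivAt_spaceDeriv hφ ht)]
    set q := pointPenalty ρ ((x, t) : RN N × ℝ) with hq
    have hqd : ContDiffOn ℝ 1 q (cyl N J) := contDiffOn_pointPenalty hρ _
    have hq0 : q (x, t) = 0 := pointPenalty_self _
    set δ : ℕ → ℝ := fun n => t ^ 2 * (1 / ((n : ℝ) + 1)) with hδ
    have hδ0 : ∀ n, 0 < δ n := fun n => by positivity
    have hδlim : Tendsto δ atTop (𝓝 0) := by
      have := (tendsto_one_div_add_atTop_nhds_zero_nat (𝕜 := ℝ)).const_mul (t ^ 2)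
      rwa [mul_zero] at this
    have hδt : ∀ n, δ n ≤ t ^ 2 := fun n => by
      refine mul_le_of_le_one_right (sq_nonneg t) ?_
      rw [div_le_one (by positivity)]
      linarith [(Nat.cast_nonneg n : (0 : ℝ) ≤ n)]
    set ψ : RN N × ℝ → ℝ := fun p => φ p + (V (x, t) - φ (x, t)) - q p with hψ
    have hψd : ContDiffOn ℝ 1 ψ (cyl N J) := (hφ.add contDiffOn_const).sub hqd
    have hψx : ψ (x, t) = V (x, t) := by
      simp only [hψ, hq0]
      ring
    have hψW : ∀ p ∈ cyl N J, ψ p + q p ≤ W p := fun p hp => by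
      have h1 : V (x, t) - φ (x, t) ≤ V p - φ p := hmin hp
      have h2 := hVW p hp
      simp only [hψ]
      linarith
    set U : ℕ → RN N × ℝ → ℝ := fun n p => max (W p) (ψ p + δ n) with hU
    have hUusc : ∀ n, UpperSemicontinuousOn (U n) (cyl N J) := fun n =>
      hW.1.sup (hψd.continuousOn.add continuousOn_const).upperSemicontinuousOn
    have hWU : ∀ n p, W p ≤ U n p := fun n p => le_max_left _ _
    have hnot : ∀ n, ¬ IsSlepcevSubsolution J c₀ c₁ u₀ (U n) := fun n hn => by
      have h1 : ∀ p ∈ cyl N J, ψ p + δ n ≤ W p := fun p hp =>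
        (le_max_right _ _).trans (hgr _ hn p hp)
      have h2 : ψ (x, t) + δ n ≤ V (x, t) :=
        le_lscEnvelope_of_continuousOn (hψd.continuousOn.add continuousOn_const) h1 hx
      linarith [hδ0 n]
    -- The inequality can only fail where the bump is on top, hence close to `(x, t)`.
    have hex : ∀ n, ∃ p ∈ cyl N J, 0 < p.2 ∧ q p ≤ δ n ∧ U n p = ψ p + δ n ∧
        cPlus c₀ c₁ (U n) p.1 p.2 * ‖spaceDeriv J ψ p‖ ≤ timeDeriv J ψ p := by
      intro n
      by_contra hcon
      refine hnot n ⟨hUusc n, fun η hη y s hs hmax => ?_⟩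
      have hy : ((y, s) : RN N × ℝ) ∈ cyl N J := ⟨mem_univ _, hs⟩
      rcases le_or_gt (ψ (y, s) + δ n) (W (y, s)) with hle | hlt
      · have hUW : U n (y, s) = W (y, s) := max_eq_left hle
        have hmaxW : IsMaxOn (fun p => W p - η p) (cyl N J) (y, s) := fun p hp => by
          have h2 : U n p - η p ≤ U n (y, s) - η (y, s) := hmax hp
          have h3 := hWU n p
          change W p - η p ≤ W (y, s) - η (y, s)
          linarith
        have h2 := hW.2 η hη y s hs hmaxW
        refine ⟨fun hs0 => (h2.1 hs0).trans ?_, ?_⟩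
        · gcongr
          exact cPlus_mono (hc₀ s hs) hs hW.1 (hUusc n) (fun z => hWU n (z, s)) hUW.symm
        · intro hs0
          subst hs0
          rw [hUW]
          exact h2.2 rfl
      · have hUψ : U n (y, s) = ψ (y, s) + δ n := max_eq_right hlt.le
        have hqδ : q (y, s) < δ n := by linarith [hψW (y, s) hy]
        have hs0 : 0 < s := by
          refine hρ.pos hs fun hs0 => ?_
          have h2 : t ^ 2 ≤ q (y, s) := by
            simp only [hq, pointPenalty, hs0]
            nlinarith [sq_nonneg ‖y - x‖, sq_nonneg (ρ 0 - ρ t)]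
          linarith [hδt n]
        have hmaxψ : IsMaxOn (fun p => ψ p - η p) (cyl N J) (y, s) := fun p hp => by
          have h2 : U n p - η p ≤ U n (y, s) - η (y, s) := hmax hp
          have h3 : ψ p + δ n ≤ U n p := le_max_right _ _
          change ψ p - η p ≤ ψ (y, s) - η (y, s)
          linarith
        obtain ⟨h2, h3⟩ := derivWithin_le_of_isMaxOn_sub hρ hψd hη hs hs0 hmaxψ
        refine ⟨fun _ => ?_, fun h => absurd h hs0.ne'⟩
        by_contra! h4
        rw [h3] at h4
        exact hcon ⟨(y, s), hy, hs0, hqδ.le, hUψ, h4.le.trans h2⟩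
    choose Q hQ hQ0 hQq hQU hQle using hex
    have hQx : Tendsto Q atTop (𝓝 (x, t)) := tendsto_of_pointPenalty (ρ := ρ)
      (squeeze_zero (fun n => pointPenalty_nonneg _ _) hQq hδlim)
    have hQw : Tendsto Q atTop (𝓝[cyl N J] (x, t)) :=
      tendsto_nhdsWithin_iff.2 ⟨hQx, Eventually.of_forall hQ⟩
    have hQ1 : Tendsto (fun n => (Q n).1) atTop (𝓝 x) := (continuous_fst.tendsto _).comp hQx
    have hQ2 : Tendsto (fun n => (Q n).2) atTop (𝓝 t) := (continuous_snd.tendsto _).comp hQx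
    have hQJ : Tendsto (fun n => (Q n).2) atTop (𝓝[J] t) :=
      tendsto_nhdsWithin_iff.2 ⟨hQ2, Eventually.of_forall fun n => (hQ n).2⟩
    have hUlim : Tendsto (fun n => U n (Q n)) atTop (𝓝 (V (x, t))) := by
      have h1 := ((hψd.continuousOn (x, t) hx).tendsto.comp hQw).add hδlim
      rw [hψx, add_zero] at h1
      exact h1.congr fun n => (hQU n).symm
    have hvel : ∀ c, c < cMinus c₀ c₁ V x t →
        ∀ᶠ n in atTop, c < cPlus c₀ c₁ (U n) (Q n).1 (Q n).2 := fun c hcc => by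
      rw [cMinus_eq] at hcc
      obtain ⟨b, hb1, hb2⟩ := exists_between (sub_lt_iff_lt_add'.2 hcc)
      have h1 := eventually_lt_setConv (l := atTop) (F := fun n => c₀ (Q n).2)
        (A := fun n => {y | U n (Q n) ≤ U n (y, (Q n).2)}) (X := fun n => (Q n).1)
        (fun n => (hUusc n).measurableSet_slice (hQ n).2 _)
        (hVlsc.measurableSet_slice ht (V (x, t))) (fun n => hc₀ _ (hQ n).2)
        ((hc.kernel_continuous t ht).tendsto.comp hQJ) hQ1 (fun z hz => by
          obtain ⟨a, ha1, ha2⟩ := exists_between (show V (x, t) < V (z, t) from hz)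
          have h2 : Tendsto (fun n => (z, (Q n).2)) atTop (𝓝[cyl N J] (z, t)) :=
            tendsto_nhdsWithin_iff.2 ⟨tendsto_const_nhds.prodMk_nhds hQ2,
              Eventually.of_forall fun n => ⟨mem_univ _, (hQ n).2⟩⟩
          filter_upwards [h2.eventually (hVlsc (z, t) ⟨mem_univ _, ht⟩ a ha2),
            hUlim.eventually (gt_mem_nhds ha1)] with n h3 h4
          have h5 := hVW (z, (Q n).2) ⟨mem_univ _, (hQ n).2⟩
          exact h4.le.trans (h3.le.trans (h5.trans (hWU n _)))) hb2
      have h2 := (hc.force_continuous (x, t) hx).tendsto.comp hQw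
      filter_upwards [h1, h2.eventually (lt_mem_nhds (sub_lt_comm.1 hb1))] with n h3 h4
      rw [cPlus_eq]
      simp only [Function.comp_apply] at h4
      linarith
    have htd : timeDeriv J ψ (x, t) = timeDeriv J φ (x, t) := by
      refine timeDeriv_eq hρ hψd ht ?_
      have := ((hasDerivWithinAt_timeDeriv hφ (x := x) ht).add_const (V (x, t) - φ (x, t))).sub
        (hasDerivWithinAt_pointPenalty hρ x ht)
      rwa [sub_zero] at this
    have hsd : spaceDeriv J ψ (x, t) = spaceDeriv J φ (x, t) := by
      refine spaceDeriv_eq hψd ht ?_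
      have := ((hasFDerivAt_spaceDeriv hφ (x := x) ht).add_const (V (x, t) - φ (x, t))).sub
        (hasFDerivAt_pointPenalty (ρ := ρ) x t)
      rwa [sub_zero] at this
    rw [← htd, ← hsd]
    have hlim1 := (continuousOn_timeDeriv hρ hψd (x, t) hx).tendsto.comp hQw
    have hlim2 := (continuousOn_spaceDeriv hρ hψd (x, t) hx).tendsto.comp hQw
    have hkey : ∀ c, c < cMinus c₀ c₁ V x t →
        c * ‖spaceDeriv J ψ (x, t)‖ ≤ timeDeriv J ψ (x, t) := fun c hcc => by
      refine le_of_tendsto_of_tendsto (hlim2.norm.const_mul c) hlim1 ?_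
      filter_upwards [hvel c hcc] with n h1
      exact (mul_le_mul_of_nonneg_right h1.le (norm_nonneg _)).trans (hQle n)
    have hlimc : Tendsto (fun c => c * ‖spaceDeriv J ψ (x, t)‖) (𝓝[<] (cMinus c₀ c₁ V x t))
        (𝓝 (cMinus c₀ c₁ V x t * ‖spaceDeriv J ψ (x, t)‖)) :=
      ((continuous_mul_const _).tendsto _).mono_left nhdsWithin_le_nhds
    exact le_of_tendsto hlimc (eventually_nhdsWithin_of_forall hkey)
  · subst h0
    refine le_of_forall_pos_le_add fun m hm => ?_
    obtain ⟨C, hC, hmod⟩ := hu₀.exists_softNorm_modulus hb hm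
    have hcont : Continuous fun p : RN N × ℝ => u₀ x - m - C * (softNorm (p.1 - x) + K * p.2) := by
      have := continuous_softNorm (N := N)
      fun_prop
    have hsub := isSlepcevSubsolution_barrier (u₀ := u₀) hρ hK hC (b := u₀ x - m) (x₀ := x)
      fun y => by
      rw [softNorm_sub_comm]
      linarith [hmod x y]
    have := le_lscEnvelope_of_continuousOn hcont.continuousOn (hgr _ hsub)
      (show ((x, 0) : RN N × ℝ) ∈ cyl N J from ⟨mem_univ _, ht⟩)
    rw [← hV] at this
    simp only [sub_self, softNorm_zero, mul_zero, add_zero, sub_zero] at this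
    linarith

end Perron

/-! ### Existence, uniqueness and continuity -/

section Solution

variable {N : ℕ} {J : Set ℝ} {T : ℝ} {ρ : ℝ → ℝ} {c₀ : ℝ → Lp ℝ 1 (volume : Measure (RN N))}
  {c₁ : RN N × ℝ → ℝ} {u₀ : RN N → ℝ} {u v w : RN N × ℝ → ℝ}

theorem IsSlepcevSubsolution.congr (hu : IsSlepcevSubsolution J c₀ c₁ u₀ u)
    (h : EqOn u w (cyl N J)) : IsSlepcevSubsolution J c₀ c₁ u₀ w := by
  refine ⟨fun p hp a ha => ?_, fun φ hφ x t ht hmax => ?_⟩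
  · change w p < a at ha
    rw [← h hp] at ha
    filter_upwards [hu.1 p hp a ha, self_mem_nhdsWithin] with q hq hqS
    change w q < a
    rwa [← h hqS]
  have hsl : ∀ y, u (y, t) = w (y, t) := fun y => h ⟨mem_univ _, ht⟩
  have hmax' : IsMaxOn (fun p => u p - φ p) (cyl N J) (x, t) := fun p hp => by
    have : w p - φ p ≤ w (x, t) - φ (x, t) := hmax hp
    change u p - φ p ≤ u (x, t) - φ (x, t)
    rwa [h hp, hsl]
  have h1 := hu.2 φ hφ x t ht hmax'
  simp only [cPlus_eq, hsl] at h1 ⊢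
  refine ⟨h1.1, fun h0 => ?_⟩
  subst h0
  rw [← hsl]
  exact h1.2 rfl

theorem IsSlepcevSupersolution.congr (hu : IsSlepcevSupersolution J c₀ c₁ u₀ u)
    (h : EqOn u w (cyl N J)) : IsSlepcevSupersolution J c₀ c₁ u₀ w := by
  refine ⟨fun p hp a ha => ?_, fun φ hφ x t ht hmin => ?_⟩
  · change w p > a at ha
    rw [← h hp] at ha
    filter_upwards [hu.1 p hp a ha, self_mem_nhdsWithin] with q hq hqS
    change w q > a
    rwa [← h hqS]
  have hsl : ∀ y, u (y, t) = w (y, t) := fun y => h ⟨mem_univ _, ht⟩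
  have hmin' : IsMinOn (fun p => u p - φ p) (cyl N J) (x, t) := fun p hp => by
    have : w (x, t) - φ (x, t) ≤ w p - φ p := hmin hp
    change u (x, t) - φ (x, t) ≤ u p - φ p
    rwa [h hp, hsl]
  have h1 := hu.2 φ hφ x t ht hmin'
  simp only [cMinus_eq, hsl] at h1 ⊢
  refine ⟨h1.1, fun h0 => ?_⟩
  subst h0
  rw [← hsl]
  exact h1.2 rfl

/-- `sub_le_modulus` for the moduli of continuity of a bounded uniformly continuous datum. -/
theorem exists_sub_le_modulus (hρ : IsTimeExhaustion J T ρ) (hc₀ : ∀ t ∈ J, 0 ≤ c₀ t)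
    (hc : VelocityRegularity J c₀ c₁) (hu₀ : UniformContinuous u₀)
    (hb : ∃ B : ℝ, ∀ x, |u₀ x| ≤ B) (hu : IsSlepcevSubsolution J c₀ c₁ u₀ u)
    (hv : IsSlepcevSupersolution J c₀ c₁ u₀ v) {m : ℝ} (hm : 0 < m) :
    ∃ C, 0 ≤ C ∧ ∀ x y, ∀ t ∈ J, u (x, t) - v (y, t) ≤ m + C * softNorm (x - y) := by
  obtain ⟨L, hL⟩ := hc.force_lipschitz
  obtain ⟨C, hC, hmod⟩ := hu₀.exists_softNorm_modulus hb hm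
  refine ⟨(C + 1) * Real.exp (2 * max L 0 * T), by positivity, fun x y t ht => ?_⟩
  have h1 := sub_le_modulus hρ hc₀ hc hu₀ hb hu hv (L := max L 0) (le_max_right _ _)
    (fun x y t ht => (hL x y t ht).trans (by gcongr; exact le_max_left _ _)) hm.le
    (by linarith : 0 < C + 1)
    (fun x y => (hmod x y).trans (by nlinarith [softNorm_nonneg (x - y)])) x y ht
  refine h1.trans ?_
  have h2 := softNorm_nonneg (x - y)
  have h3 := hρ.le t ht
  gcongr

/-- The comparison principle. -/
theorem IsSlepcevSubsolution.le_supersolution (hu : IsSlepcevSubsolution J c₀ c₁ u₀ u)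
    (hρ : IsTimeExhaustion J T ρ) (hc₀ : ∀ t ∈ J, 0 ≤ c₀ t) (hc : VelocityRegularity J c₀ c₁)
    (hu₀ : UniformContinuous u₀) (hb : ∃ B : ℝ, ∀ x, |u₀ x| ≤ B)
    (hv : IsSlepcevSupersolution J c₀ c₁ u₀ v) {p : RN N × ℝ} (hp : p ∈ cyl N J) : u p ≤ v p := by
  refine le_of_forall_pos_le_add fun m hm => ?_
  obtain ⟨C, -, h⟩ := exists_sub_le_modulus hρ hc₀ hc hu₀ hb hu hv hm
  have h1 := h p.1 p.1 p.2 hp.2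
  simp only [Prod.mk.eta, sub_self, softNorm_zero, mul_zero, add_zero] at h1
  linarith

/-- A function that is both a subsolution and a supersolution is uniformly continuous in space and
time: the spatial modulus propagates, and it yields a modulus in time by finite speed of
propagation. -/
theorem exists_modulus_of_subsolution_of_supersolution (hρ : IsTimeExhaustion J T ρ)
    (hc₀ : ∀ t ∈ J, 0 ≤ c₀ t) (hc : VelocityRegularity J c₀ c₁) (hu₀ : UniformContinuous u₀)
    (hb : ∃ B : ℝ, ∀ x, |u₀ x| ≤ B) (hu : IsSlepcevSubsolution J c₀ c₁ u₀ u)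
    (hv : IsSlepcevSupersolution J c₀ c₁ u₀ u) {m : ℝ} (hm : 0 < m) :
    ∃ C K : ℝ, ∀ x y, ∀ t ∈ J, ∀ s ∈ J,
      |u (x, t) - u (y, s)| ≤ m + C * (softNorm (x - y) + K * |t - s|) := by
  obtain ⟨K, hK0, hK⟩ := hc.exists_isSpeedBound
  obtain ⟨B, hB⟩ := hb
  have hue := hu.isEikonalSubsolution hK
  have hve := hv.isEikonalSubsolution_neg hK
  obtain ⟨C, hC, hmod⟩ := exists_sub_le_modulus hρ hc₀ hc hu₀ ⟨B, hB⟩ hu hv hm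
  have key : ∀ x y, ∀ t ∈ J, ∀ s ∈ J, s ≤ t →
      |u (x, t) - u (y, s)| ≤ m + C * (softNorm (x - y) + K * |t - s|) := by
    intro x y t ht s hs hst
    have h1 := hue.le_barrier_from hρ hK0.le (B := B)
      (fun p hp => hue.le_of_initial_le hρ hK0.le (fun x => (abs_le.1 (hB x)).2) hp)
      (A := u (y, s) + m) hC hs (x₀ := y) (fun z => by linarith [hmod z y s hs]) (x₁ := x) ht hst
    have h2 := hve.le_barrier_from hρ hK0.le (B := B)
      (fun p hp => hve.le_of_initial_le hρ hK0.le (fun x => by linarith [(abs_le.1 (hB x)).1]) hp)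
      (A := -u (y, s) + m) hC hs (x₀ := y) (fun z => by
        rw [softNorm_sub_comm]
        linarith [hmod y z s hs]) (x₁ := x) ht hst
    rw [abs_of_nonneg (sub_nonneg.2 hst)]
    exact abs_le.2 ⟨by linarith, by linarith⟩
  refine ⟨C, K, fun x y t ht s hs => ?_⟩
  rcases le_total s t with hst | hst
  · exact key x y t ht s hs hst
  · rw [abs_sub_comm, softNorm_sub_comm, abs_sub_comm t s]
    exact key y x s hs t ht hst

/-- A real function whose oscillation is controlled by continuous functions that are arbitrarily
small at `(p, p)` has a limit at `p`. -/
theorem exists_tendsto_of_forall_abs_sub_le {X : Type*} [TopologicalSpace X] {S : Set X} {p : X}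
    (hp : p ∈ closure S) {f : X → ℝ}
    (h : ∀ e : ℝ, 0 < e → ∃ g : X × X → ℝ, Continuous g ∧ g (p, p) < e ∧
      ∀ P ∈ S, ∀ Q ∈ S, |f P - f Q| ≤ g (P, Q)) : ∃ a, Tendsto f (𝓝[S] p) (𝓝 a) := by
  have hne : (𝓝[S] p).NeBot := mem_closure_iff_nhdsWithin_neBot.1 hp
  rw [← cauchy_map_iff_exists_tendsto, Metric.cauchy_iff]
  refine ⟨hne.map f, fun e he => ?_⟩
  obtain ⟨g, hg, hge, hfg⟩ := h e he
  obtain ⟨A, hA, B, hB, hAB⟩ := mem_nhds_prod_iff.1 ((isOpen_lt hg continuous_const).mem_nhds hge)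
  have hS : A ∩ B ∩ S ∈ 𝓝[S] p :=
    inter_mem (mem_nhdsWithin_of_mem_nhds (inter_mem hA hB)) self_mem_nhdsWithin
  refine ⟨_, image_mem_map hS, ?_⟩
  rintro _ ⟨P, hP, rfl⟩ _ ⟨Q, hQ, rfl⟩
  have h1 : g (P, Q) < e := hAB (mk_mem_prod hP.1.1 hQ.1.2)
  rw [Real.dist_eq]
  exact (hfg P hP.2 Q hQ.2).trans_lt h1

/-- A function on the cylinder with a modulus of continuity has limits at all points of the closed
cylinder. -/
theorem exists_tendsto_of_modulus
    (h : ∀ m : ℝ, 0 < m → ∃ C K : ℝ, ∀ x y, ∀ t ∈ J, ∀ s ∈ J,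
      |u (x, t) - u (y, s)| ≤ m + C * (softNorm (x - y) + K * |t - s|)) {p : RN N × ℝ}
    (hp : p ∈ closure (cyl N J)) : ∃ a, Tendsto u (𝓝[cyl N J] p) (𝓝 a) := by
  refine exists_tendsto_of_forall_abs_sub_le hp fun e he => ?_
  obtain ⟨C, K, hCK⟩ := h (e / 2) (half_pos he)
  refine ⟨fun P => e / 2 + C * (softNorm (P.1.1 - P.2.1) + K * |P.1.2 - P.2.2|), ?_, ?_, ?_⟩
  · have := continuous_softNorm (N := N)
    fun_prop
  · simp only [sub_self, softNorm_zero, abs_zero, mul_zero, add_zero]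
    exact half_lt_self he
  · exact fun P hP Q hQ => hCK P.1 Q.1 P.2 hP.2 Q.2 hQ.2

end Solution

theorem theorem3 (N : ℕ) (T : ℝ) (hT : 0 < T)
    (J : Set ℝ) (hJ : J = Ico 0 T ∨ J = Icc 0 T)
    (c₀ : ℝ → Lp ℝ 1 (volume : Measure (RN N))) (c₁ : RN N × ℝ → ℝ) (u₀ : RN N → ℝ)
    (hc₀ : ∀ t ∈ J, 0 ≤ c₀ t)
    (hc : VelocityRegularity J c₀ c₁)
    (hu₀ : UniformContinuous u₀) (hu₀_bdd : ∃ B : ℝ, ∀ x, |u₀ x| ≤ B) :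
    ∃ u : RN N × ℝ → ℝ,
      ContinuousOn u (cyl N (Icc 0 T)) ∧
      (∀ x, u (x, 0) = u₀ x) ∧
      IsSlepcevSolution J c₀ c₁ u₀ u ∧
      ∀ v : RN N × ℝ → ℝ, IsSlepcevSolution J c₀ c₁ u₀ v → EqOn v u (cyl N J) := by
  obtain ⟨ρ, hρ⟩ := exists_isTimeExhaustion hT hJ
  obtain ⟨K, hK0, hK⟩ := hc.exists_isSpeedBound
  obtain ⟨W, hW, hgr⟩ := exists_greatest_subsolution hρ hc₀ hc hu₀ hu₀_bdd
  have hWlb : LocallyBoundedOn W (cyl N J) := by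
    obtain ⟨B, hB⟩ := hu₀_bdd
    refine .of_forall_abs_le (C := B) fun p hp => abs_le.2 ⟨?_, ?_⟩
    · have h1 : IsSlepcevSubsolution J c₀ c₁ u₀
          fun p => -B - 0 * (softNorm (p.1 - 0) + K * p.2) :=
        isSlepcevSubsolution_barrier hρ hK le_rfl fun x => by linarith [(abs_le.1 (hB x)).1]
      simpa using hgr _ h1 p hp
    · exact (hW.isEikonalSubsolution hK).le_of_initial_le hρ hK0.le
        (fun x => (abs_le.1 (hB x)).2) hp
  have hV := isSlepcevSupersolution_of_greatest hρ hc₀ hc hu₀ hu₀_bdd hWlb hW hgr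
  have hVW : EqOn (lscEnvelope (cyl N J) W) W (cyl N J) := fun p hp =>
    le_antisymm (hWlb.lscEnvelope_le hp) (hW.le_supersolution hρ hc₀ hc hu₀ hu₀_bdd hV hp)
  have hWsup := hV.congr hVW
  have hlim : ∀ p ∈ cyl N (Icc 0 T), ∃ a, Tendsto W (𝓝[cyl N J] p) (𝓝 a) := fun p hp => by
    refine exists_tendsto_of_modulus (fun m hm =>
      exists_modulus_of_subsolution_of_supersolution hρ hc₀ hc hu₀ hu₀_bdd hW hWsup hm) ?_
    rw [cyl, closure_prod_eq, closure_univ]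
    exact ⟨mem_univ _, hρ.Icc_subset_closure hp.2⟩
  have hsub : cyl N (Icc 0 T) ⊆ closure (cyl N J) := fun p hp => by
    rw [cyl, closure_prod_eq, closure_univ]
    exact ⟨mem_univ _, hρ.Icc_subset_closure hp.2⟩
  have hWc : ContinuousOn W (cyl N J) :=
    continuousOn_iff_lower_upperSemicontinuousOn.2 ⟨hWsup.1, hW.1⟩
  set u := extendFrom (cyl N J) W with hu
  have huW : EqOn W u (cyl N J) := fun p hp =>
    (extendFrom_eq (subset_closure hp) (hWc p hp)).symm
  have huc : ContinuousOn u (cyl N J) := hWc.congr huW.symm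
  have hne : ∀ p ∈ cyl N J, (𝓝[cyl N J] p).NeBot := fun p hp =>
    mem_closure_iff_nhdsWithin_neBot.1 (subset_closure hp)
  have husc : EqOn W (uscEnvelope (cyl N J) u) (cyl N J) := fun p hp => by
    have := hne p hp
    rw [huW hp]
    exact (huc p hp).tendsto.limsup_eq.symm
  have hlsc : EqOn W (lscEnvelope (cyl N J) u) (cyl N J) := fun p hp => by
    have := hne p hp
    rw [huW hp]
    exact (huc p hp).tendsto.liminf_eq.symm
  refine ⟨u, continuousOn_extendFrom hsub hlim, fun x => ?_,
    ⟨fun p hp => ?_, hW.congr husc, hWsup.congr hlsc⟩, fun v hv p hp => ?_⟩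
  · have hx : ((x, 0) : RN N × ℝ) ∈ cyl N J := ⟨mem_univ _, hρ.zero_mem⟩
    rw [← huW hx]
    refine le_antisymm (le_of_forall_pos_le_add fun m hm => ?_)
      (le_of_forall_pos_le_add fun m hm => ?_)
    · obtain ⟨δ, hδ, h⟩ := (hW.isEikonalSubsolution hK).exists_initial_layer hρ hK0.le hu₀ hu₀_bdd
        hm
      exact h 0 hρ.zero_mem hδ.le x
    · obtain ⟨δ, hδ, h⟩ := (hWsup.isEikonalSubsolution_neg hK).exists_initial_layer hρ hK0.le
        hu₀.neg (by simpa using hu₀_bdd) hm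
      linarith [h 0 hρ.zero_mem hδ.le x]
  · obtain ⟨C, hC⟩ := hWlb p hp
    refine ⟨C, ?_⟩
    filter_upwards [hC, self_mem_nhdsWithin] with q hq hqS
    rwa [← huW hqS]
  · rw [← huW hp]
    refine le_antisymm ((hv.1.le_uscEnvelope hp).trans (hgr _ hv.2.1 p hp)) ?_
    exact (hW.le_supersolution hρ hc₀ hc hu₀ hu₀_bdd hv.2.2 hp).trans (hv.1.lscEnvelope_le hp)
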